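/- **Theorem 5.12 (Structure Theorem).** All rings are associative with unit (not necessarily commutative) and ring morphisms preserve units; $\mathcal{M}_R$ is the category of right $R$-modules. Let $G$ be a group with unit element $e$ and $A$ a ring. A *$G$-$A$-coring* $\underline{\mathcal{C}}$ is a family $(\mathcal{C}_\alpha)_{\alpha\in G}$ of $A$-bimodules with $A$-bimodule maps $\Delta_{\alpha,\beta}:\mathcal{C}_{\alpha\beta}\to\mathcal{C}_\alpha\otimes_A\mathcal{C}_\beta$ and $\varepsilon:\mathcal{C}_e\to A$ such that, for all $\alpha,\beta,\gamma\in G$, $(\Delta_{\alpha,\beta}\otimes_A\mathcal{C}_\gamma)\circ\Delta_{\alpha\beta,\gamma}=(\mathcal{C}_\alpha\otimes_A\Delta_{\beta,\gamma})\circ\Delta_{\alpha,\beta\gamma}$ and $(\mathcal{C}_\alpha\otimes_A\varepsilon)\circ\Delta_{\alpha,e}=\mathcal{C}_\alpha=(\varepsilon\otimes_A\mathcal{C}_\alpha)\circ\Delta_{e,\alpha}$; here an object also denotes its identity map. A morphism of $G$-$A$-corings is a family of $A$-bimodule maps $f_\alpha$ with $(f_\alpha\otimes_A f_\beta)\circ\Delta_{\alpha,\beta}=\Delta_{\alpha,\beta}\circ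 f_{\alpha\beta}$ and $\varepsilon\circ f_e=\varepsilon$. A *right $G$-$\underline{\mathcal{C}}$-comodule* $\underline{M}$ is a family $(M_\alpha)_{\alpha\in G}$ of right $A$-modules with right $A$-linear maps $\rho_{\alpha,\beta}:M_{\alpha\beta}\to M_\alpha\otimes_A\mathcal{C}_\beta$ such that $(M_\alpha\otimes_A\Delta_{\beta,\gamma})\circ\rho_{\alpha,\beta\gamma}=(\rho_{\alpha,\beta}\otimes_A\mathcal{C}_\gamma)\circ\rho_{\alpha\beta,\gamma}$ and $(M_\alpha\otimes_A\varepsilon)\circ\rho_{\alpha,e}=M_\alpha$. A morphism is a family of right $A$-linear maps $f_\alpha$ with $(f_\alpha\otimes_A\mathcal{C}_\beta)\circ\rho_{\alpha,\beta}=\rho_{\alpha,\beta}\circ f_{\alpha\beta}$. The resulting category is $\mathcal{M}^{G,\underline{\mathcal{C}}}$. Let $\underline{x}=(x_\alpha)_{\alpha\in G}$ be a *grouplike family* of $\underline{\mathcal{C}}$: $x_\alpha\in\mathcal{C}_\alpha$, $\Delta_{\alpha,\beta}(x_{\alpha\beta})=x_\alpha\otimes_A x_\beta$ for all $\alpha,\beta\in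 G$, and $\varepsilon(x_e)=1$. Let $T=A^{\mathrm{co}\,\underline{\mathcal{C}}}=\{a\in A\mid ax_\alpha=x_\alpha a\ \text{for all}\ \alpha\in G\}$, a subring of $A$. Let $\underline{\mathcal{D}}=(A\otimes_T A)\langle G\rangle$ be the $G$-$A$-coring with $\mathcal{D}_\alpha=A\otimes_T A$ for all $\alpha$, comultiplications $\Delta_{\alpha,\beta}(a\otimes_T b)=(a\otimes_T 1)\otimes_A(1\otimes_T b)$ and counit $a\otimes_T b\mapsto ab$. The pair $(\underline{\mathcal{C}},\underline{x})$ is a *Galois group coring* if the morphism $\underline{\mathrm{can}}:\underline{\mathcal{D}}\to\underline{\mathcal{C}}$, $\mathrm{can}_\alpha(a\otimes_T b)=ax_\alpha b$, is an isomorphism of $G$-$A$-corings. Let $B$ be a ring and $i:B\to T$ a ring morphism; via $i$, every $A$-module is regarded as a $B$-module. Consider the following adjoint functors between $\mathcal{M}_B$ and $\mathcal{M}^{G,\underline{\mathcal{C}}}$. The left adjoint $F_7=G_1\circ(-\otimes_B A)$ sends $N$ to the family with every component equal to $N\otimes_B A$ and with $\rho_{\alpha,\beta}(n\otimes_B a)=(n\otimes_B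 1)\otimes_A x_\beta a$. (Thus $-\otimes_B A$ takes values in right $\underline{\mathcal{C}}$-comodules, that is, right $A$-modules $M$ with suitable coactions $\rho_\alpha:M\to M\otimes_A\mathcal{C}_\alpha$, and $G_1(M)$ is the constant family $M$ with $\rho_{\alpha,\beta}=\rho_\beta$.) The right adjoint is $$G_7(\underline{M})=\underline{M}^{\mathrm{co}\,\underline{\mathcal{C}}}=\Big\{(m_\alpha)_\alpha\in\prod_{\alpha\in G}M_\alpha\ \Big|\ \rho_{\alpha,\beta}(m_{\alpha\beta})=m_\alpha\otimes_A x_\beta\ \text{for all}\ \alpha,\beta\in G\Big\}.$$ The unit is $n\mapsto(n\otimes_B 1)_{\alpha\in G}$ and the counit has components $(m_\beta)_\beta\otimes_B a\mapsto m_\alpha a$. Then the following assertions are equivalent: 1. $i:B\to A^{\mathrm{co}\,\underline{\mathcal{C}}}$ is an isomorphism, $(\underline{\mathcal{C}},\underline{x})$ is a Galois group coring, and $A$ is faithfully flat as a left $B$-module; 2. $(F_7,G_7)$ is a pair of inverse equivalences between $\mathcal{M}_B$ and $\mathcal{M}^{G,\underline{\mathcal{C}}}$ (the unit and the counit of the adjunction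 are isomorphisms), and $A$ is flat as a left $B$-module. -/

import Mathlib

open CategoryTheory MulOpposite

universe u

/-! ### Tensor products over a noncommutative ring

Right `R`-modules are modules over `Rᵐᵒᵖ`, so that `op r • m` is the element `m r`. -/

section TensorProduct

variable (R : Type u) [Ring R]

/-- The subgroup of `M ⊗_ℤ N` generated by the elements `m r ⊗ n - m ⊗ r n`. -/
def balancedRelations (M N : Type u) [AddCommGroup M] [Module Rᵐᵒᵖ M] [AddCommGroup N]
    [Module R N] : AddSubgroup (TensorProduct ℤ M N) :=
  AddSubgroup.closure {t | ∃ (m : M) (r : R) (n : N),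
    t = TensorProduct.tmul ℤ (op r • m) n - TensorProduct.tmul ℤ m (r • n)}

/-- The tensor product `M ⊗_R N` of a right `R`-module `M` and a left `R`-module `N`. -/
def BTensor (M N : Type u) [AddCommGroup M] [Module Rᵐᵒᵖ M] [AddCommGroup N]
    [Module R N] : Type u :=
  TensorProduct ℤ M N ⧸ balancedRelations R M N

namespace BTensor

section Basic

variable {M N P M' N' M'' N'' : Type u}
  [AddCommGroup M] [Module Rᵐᵒᵖ M] [AddCommGroup N] [Module R N] [AddCommGroup P]
  [AddCommGroup M'] [Module Rᵐᵒᵖ M'] [AddCommGroup N'] [Module R N']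
  [AddCommGroup M''] [Module Rᵐᵒᵖ M''] [AddCommGroup N''] [Module R N'']

instance : AddCommGroup (BTensor R M N) :=
  inferInstanceAs (AddCommGroup (TensorProduct ℤ M N ⧸ balancedRelations R M N))

/-- The pure tensor `m ⊗ n`. -/
def tmul (m : M) (n : N) : BTensor R M N :=
  QuotientAddGroup.mk (TensorProduct.tmul ℤ m n)

theorem add_tmul (m m' : M) (n : N) : tmul R (m + m') n = tmul R m n + tmul R m' n := by
  unfold tmul
  rw [TensorProduct.add_tmul]
  rfl

theorem tmul_add (m : M) (n n' : N) : tmul R m (n + n') = tmul R m n + tmul R m n' := by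
  unfold tmul
  rw [TensorProduct.tmul_add]
  rfl

theorem smul_tmul (m : M) (r : R) (n : N) : tmul R (op r • m) n = tmul R m (r • n) := by
  refine (QuotientAddGroup.eq_iff_sub_mem).2 ?_
  exact AddSubgroup.subset_closure ⟨m, r, n, rfl⟩

/-- The universal property of the tensor product. -/
def lift (f : M →+ N →+ P) (hf : ∀ (m : M) (r : R) (n : N), f (op r • m) n = f m (r • n)) :
    BTensor R M N →+ P :=
  QuotientAddGroup.lift (balancedRelations R M N)
    (TensorProduct.liftAddHom f (fun r m n => by simp))
    ((AddSubgroup.closure_le _).2 (by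
      rintro _ ⟨m, r, n, rfl⟩
      simp [AddMonoidHom.mem_ker, hf]))

@[simp]
theorem lift_tmul (f : M →+ N →+ P) (hf) (m : M) (n : N) :
    lift R f hf (tmul R m n) = f m n := rfl

variable {R} in
@[elab_as_elim]
theorem induction {p : BTensor R M N → Prop} (t : BTensor R M N)
    (tmul : ∀ m n, p (tmul R m n)) (add : ∀ a b, p a → p b → p (a + b)) : p t := by
  obtain ⟨t, rfl⟩ := QuotientAddGroup.mk_surjective t
  induction t using TensorProduct.induction_on with
  | zero => 
    have := tmul 0 0
    unfold BTensor.tmul at this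
    rwa [TensorProduct.zero_tmul] at this
  | tmul m n => exact tmul m n
  | add a b ha hb => exact add _ _ ha hb

variable {R} in
theorem addHom_ext {f g : BTensor R M N →+ P} (h : ∀ m n, f (tmul R m n) = g (tmul R m n)) :
    f = g := by
  ext t
  induction t using induction with
  | tmul m n => exact h m n
  | add a b ha hb => rw [map_add, map_add, ha, hb]

/-- A variant of `lift` for functions of two /-- The element `a` of `A`, seen in the bimodule. -/
def of (a : A) : ResLeft f := a. -/
def lift₂ (f : M → N → P) (h1 : ∀ m m' n, f (m + m') n = f m n + f m' n)
    (h2 : ∀ m n n', f m (n + n') = f m n + f m n')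
    (hf : ∀ (m : M) (r : R) (n : N), f (op r • m) n = f m (r • n)) : BTensor R M N →+ P :=
  lift R (AddMonoidHom.mk' (fun m => AddMonoidHom.mk' (f m) (h2 m))
    (fun m m' => AddMonoidHom.ext (h1 m m'))) hf

@[simp]
theorem lift₂_tmul (f : M → N → P) (h1 h2 hf) (m : M) (n : N) :
    lift₂ R f h1 h2 hf (tmul R m n) = f m n := rfl

variable {R}

/-- `f ⊗_R g` for a right `R`-linear map `f` and a left `R`-linear map `g`. -/
def map (f : M →ₗ[Rᵐᵒᵖ] M') (g : N →ₗ[R] N') : BTensor R M N →+ BTensor R M' N' :=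
  lift₂ R (fun m n => tmul R (f m) (g n))
    (fun m m' n => by rw [map_add, add_tmul])
    (fun m n n' => by rw [map_add, tmul_add])
    (fun m r n => by rw [map_smul, map_smul, smul_tmul])

@[simp]
theorem map_tmul (f : M →ₗ[Rᵐᵒᵖ] M') (g : N →ₗ[R] N') (m : M) (n : N) :
    map f g (tmul R m n) = tmul R (f m) (g n) := rfl

theorem map_id_apply (t : BTensor R M N) : map LinearMap.id LinearMap.id t = t := by
  induction t using induction with
  | tmul m n => rfl
  | add a b ha hb => rw [map_add, ha, hb]

theorem map_map (f' : M' →ₗ[Rᵐᵒᵖ] M'') (g' : N' →ₗ[R] N'') (f : M →ₗ[Rᵐᵒᵖ] M')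
    (g : N →ₗ[R] N') (t : BTensor R M N) :
    map f' g' (map f g t) = map (f' ∘ₗ f) (g' ∘ₗ g) t := by
  induction t using induction with
  | tmul m n => rfl
  | add a b ha hb => rw [map_add, map_add, ha, hb, map_add]

end Basic

section Actions

variable {R}
variable {S : Type u} [Ring S]
variable {M N M' N' : Type u} [AddCommGroup M] [Module Rᵐᵒᵖ M] [AddCommGroup N] [Module R N]
  [AddCommGroup M'] [Module Rᵐᵒᵖ M'] [AddCommGroup N'] [Module R N']

section Left

variable [Module S M] [SMulCommClass S Rᵐᵒᵖ M]

/-- Left multiplication by `s` as a right `R`-linear map. -/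
def leftMul (s : S) : M →ₗ[Rᵐᵒᵖ] M where
  toFun m := s • m
  map_add' := smul_add s
  map_smul' r m := smul_comm s r m

/-- If `M` is an `(S, R)`-bimodule, then `M ⊗_R N` is a left `S`-module: `s (m ⊗ n) = s m ⊗ n`. -/
instance leftModule : Module S (BTensor R M N) where
  smul s t := map (leftMul s) LinearMap.id t
  one_smul t := by
    change map (leftMul (1 : S)) LinearMap.id t = t
    induction t using induction with
    | tmul m n => simp [leftMul]
    | add a b ha hb => rw [map_add, ha, hb]
  mul_smul s s' t := by
    change map (leftMul (s * s')) LinearMap.id t =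
      map (leftMul s) LinearMap.id (map (leftMul s') LinearMap.id t)
    induction t using induction with
    | tmul m n => simp [leftMul, mul_smul]
    | add a b ha hb => rw [map_add, ha, hb, map_add, map_add]
  smul_zero s := map_zero _
  smul_add s t t' := map_add _ t t'
  add_smul s s' t := by
    change map (leftMul (s + s')) LinearMap.id t =
      map (leftMul s) LinearMap.id t + map (leftMul s') LinearMap.id t
    induction t using induction with
    | tmul m n => simp [leftMul, add_smul, add_tmul]
    | add a b ha hb => rw [map_add, ha, hb, map_add, map_add]; abel
  zero_smul t := by
    change map (leftMul (0 : S)) LinearMap.id t = 0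
    induction t using induction with
    | tmul m n =>
      have h := add_tmul R (0 : M) 0 n
      simpa [leftMul] using h
    | add a b ha hb => rw [map_add, ha, hb, add_zero]

@[simp]
theorem left_smul_tmul (s : S) (m : M) (n : N) : s • tmul R m n = tmul R (s • m) n := rfl

end Left

section Right

variable [Module Sᵐᵒᵖ N] [SMulCommClass R Sᵐᵒᵖ N]

/-- Right multiplication by `s` as a left `R`-linear map. -/
def rightMul (s : Sᵐᵒᵖ) : N →ₗ[R] N where
  toFun n := s • n
  map_add' := smul_add s
  map_smul' r n := (smul_comm r s n).symm

/-- If `N` is an `(R, S)`-bimodule, then `M ⊗_R N` is a right `S`-module: `(m ⊗ n) s = m ⊗ n s`. -/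
instance rightModule : Module Sᵐᵒᵖ (BTensor R M N) where
  smul s t := map LinearMap.id (rightMul s) t
  one_smul t := by
    change map LinearMap.id (rightMul (1 : Sᵐᵒᵖ)) t = t
    induction t using induction with
    | tmul m n => simp [rightMul]
    | add a b ha hb => rw [map_add, ha, hb]
  mul_smul s s' t := by
    change map LinearMap.id (rightMul (s * s')) t =
      map LinearMap.id (rightMul s) (map LinearMap.id (rightMul s') t)
    induction t using induction with
    | tmul m n => simp [rightMul, mul_smul]
    | add a b ha hb => rw [map_add, ha, hb, map_add, map_add]
  smul_zero s := map_zero _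
  smul_add s t t' := map_add _ t t'
  add_smul s s' t := by
    change map LinearMap.id (rightMul (s + s')) t =
      map LinearMap.id (rightMul s) t + map LinearMap.id (rightMul s') t
    induction t using induction with
    | tmul m n => simp [rightMul, add_smul, tmul_add]
    | add a b ha hb => rw [map_add, ha, hb, map_add, map_add]; abel
  zero_smul t := by
    change map LinearMap.id (rightMul (0 : Sᵐᵒᵖ)) t = 0
    induction t using induction with
    | tmul m n =>
      have h := tmul_add R m (0 : N) 0
      simpa [rightMul] using h
    | add a b ha hb => rw [map_add, ha, hb, add_zero]

@[simp]
theorem right_smul_tmul (s : Sᵐᵒᵖ) (m : M) (n : N) : s • tmul R m n = tmul R m (s • n) := rfl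

/-- `f ⊗_R N` as a right `S`-linear map. -/
def rTensor (f : M →ₗ[Rᵐᵒᵖ] M') : BTensor R M N →ₗ[Sᵐᵒᵖ] BTensor R M' N where
  toFun := map f LinearMap.id
  map_add' := map_add _
  map_smul' s t := by
    induction t using induction with
    | tmul m n => rfl
    | add a b ha hb => rw [smul_add, map_add, ha, hb, map_add, smul_add]

variable (S) in
theorem linearMap_ext {P : Type u} [AddCommGroup P] [Module Sᵐᵒᵖ P]
    {f g : BTensor R M N →ₗ[Sᵐᵒᵖ] P} (h : ∀ m n, f (tmul R m n) = g (tmul R m n)) : f = g :=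
  LinearMap.ext fun t => DFunLike.congr_fun
    (addHom_ext (f := f.toAddMonoidHom) (g := g.toAddMonoidHom) h) t

end Right

instance {T : Type u} [Ring T] [Module T M] [SMulCommClass T Rᵐᵒᵖ M] [Module Sᵐᵒᵖ N]
    [SMulCommClass R Sᵐᵒᵖ N] : SMulCommClass T Sᵐᵒᵖ (BTensor R M N) where
  smul_comm a s t := by
    induction t using induction with
    | tmul m n => rfl
    | add a b ha hb => simp only [smul_add, ha, hb]

end Actions

section Canonical

variable {R}
variable {S : Type u} [Ring S]
variable {M N P : Type u} [AddCommGroup M] [Module Rᵐᵒᵖ M] [AddCommGroup N] [Module R N]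
  [Module Sᵐᵒᵖ N] [SMulCommClass R Sᵐᵒᵖ N] [AddCommGroup P] [Module S P]

/-- `m ⊗ n ↦ m ⊗ (n ⊗ p)` for fixed `p`. -/
def assocFun (p : P) : BTensor R M N →+ BTensor R M (BTensor S N P) :=
  lift₂ R (fun m n => tmul R m (tmul S n p))
    (fun m m' n => add_tmul R m m' _)
    (fun m n n' => by rw [add_tmul, tmul_add])
    (fun m r n => by rw [smul_tmul, left_smul_tmul])

/-- `n ⊗ p ↦ (m ⊗ n) ⊗ p` for fixed `m`. -/
def assocInvFun (m : M) : BTensor S N P →+ BTensor S (BTensor R M N) P :=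
  lift₂ S (fun n p => tmul S (tmul R m n) p)
    (fun n n' p => by rw [tmul_add, add_tmul])
    (fun n p p' => tmul_add S _ p p')
    (fun n s p => by rw [← right_smul_tmul, smul_tmul])

/-- The associativity isomorphism `(M ⊗_R N) ⊗_S P ≅ M ⊗_R (N ⊗_S P)`,
`(m ⊗ n) ⊗ p ↦ m ⊗ (n ⊗ p)`. -/
def assoc : BTensor S (BTensor R M N) P ≃+ BTensor R M (BTensor S N P) :=
  AddMonoidHom.toAddEquiv
    (lift₂ S (fun t p => assocFun p t)
      (fun t t' p => map_add _ t t')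
      (fun t p p' => by
        induction t using induction with
        | tmul m n => simp [assocFun, tmul_add]
        | add a b ha hb => rw [map_add, ha, hb, map_add, map_add]; abel)
      (fun t s p => by
        induction t using induction with
        | tmul m n => simp [assocFun, smul_tmul]
        | add a b ha hb => rw [smul_add, map_add, ha, hb, map_add]))
    (lift₂ R (fun m t => assocInvFun m t)
      (fun m m' t => by
        induction t using induction with
        | tmul n p => simp [assocInvFun, add_tmul]
        | add a b ha hb => rw [map_add, ha, hb, map_add, map_add]; abel)
      (fun m t t' => map_add _ t t')
      (fun m r t => by
        induction t using induction with
        | tmul n p => simp [assocInvFun, smul_tmul]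
        | add a b ha hb => rw [smul_add, map_add, ha, hb, map_add]))
    (addHom_ext fun t p => by
      induction t using induction with
      | tmul m n => rfl
      | add a b ha hb => rw [add_tmul, map_add, map_add, ha, hb])
    (addHom_ext fun m t => by
      induction t using induction with
      | tmul n p => rfl
      | add a b ha hb => rw [tmul_add, map_add, map_add, ha, hb])

@[simp]
theorem assoc_tmul (m : M) (n : N) (p : P) :
    assoc (tmul S (tmul R m n) p) = tmul R m (tmul S n p) := rfl

variable (R M) in
/-- The canonical map `M ⊗_R R ≅ M`, `m ⊗ r ↦ m r`. -/
def rid : BTensor R M R →+ M :=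
  lift₂ R (fun m r => op r • m) (fun m m' r => smul_add _ m m')
    (fun m r r' => by rw [MulOpposite.op_add, add_smul])
    (fun m r r' => by rw [smul_smul, smul_eq_mul, op_mul])

variable (R N) in
/-- The canonical map `R ⊗_R N ≅ N`, `r ⊗ n ↦ r n`. -/
def lid : BTensor R R N →+ N :=
  lift₂ R (fun r n => r • n) (fun r r' n => add_smul r r' n)
    (fun r n n' => smul_add r n n')
    (fun r r' n => by rw [op_smul_eq_mul, mul_smul])

@[simp]
theorem rid_tmul (m : M) (r : R) : rid R M (tmul R m r) = op r • m := rfl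

@[simp]
theorem lid_tmul (r : R) (n : N) : lid R N (tmul R r n) = r • n := rfl

end Canonical

end BTensor

/-- A left `R`-module `P` is flat if `- ⊗_R P` preserves injectivity of maps of right
`R`-modules. -/
def IsLeftFlat (P : Type u) [AddCommGroup P] [Module R P] : Prop :=
  ∀ (M N : Type u) [AddCommGroup M] [Module Rᵐᵒᵖ M] [AddCommGroup N] [Module Rᵐᵒᵖ N]
    (f : M →ₗ[Rᵐᵒᵖ] N), Function.Injective f →
      Function.Injective (BTensor.map f (LinearMap.id : P →ₗ[R] P))

/-- A left `R`-module `P` is faithfully flat if it is flat and `M ⊗_R P = 0` implies `M = 0`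
for every right `R`-module `M`. -/
def IsLeftFaithfullyFlat (P : Type u) [AddCommGroup P] [Module R P] : Prop :=
  IsLeftFlat R P ∧ ∀ (M : Type u) [AddCommGroup M] [Module Rᵐᵒᵖ M],
    Subsingleton (BTensor R M P) → Subsingleton M

end TensorProduct

/-! ### Bimodule maps -/

/-- A map of `(R, S)`-bimodules. -/
structure BimodHom (R S : Type u) [Ring R] [Ring S] (M N : Type u) [AddCommGroup M]
    [Module R M] [Module Sᵐᵒᵖ M] [AddCommGroup N] [Module R N] [Module Sᵐᵒᵖ N]
    extends M →+ N where
  map_smul_left' : ∀ (r : R) (m : M), toFun (r • m) = r • toFun m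
  map_smul_right' : ∀ (s : S) (m : M), toFun (op s • m) = op s • toFun m

namespace BimodHom

variable {R S : Type u} [Ring R] [Ring S] {M N P : Type u} [AddCommGroup M]
  [Module R M] [Module Sᵐᵒᵖ M] [AddCommGroup N] [Module R N] [Module Sᵐᵒᵖ N]
  [AddCommGroup P] [Module R P] [Module Sᵐᵒᵖ P]

instance : FunLike (BimodHom R S M N) M N where
  coe f := f.toFun
  coe_injective f g h := by
    cases f; cases g
    congr
    exact DFunLike.coe_injective h

instance : AddMonoidHomClass (BimodHom R S M N) M N where
  map_add f := f.map_add'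
  map_zero f := f.toAddMonoidHom.map_zero

theorem map_smul_left (f : BimodHom R S M N) (r : R) (m : M) : f (r • m) = r • f m :=
  f.map_smul_left' r m

theorem map_smul_right (f : BimodHom R S M N) (s : S) (m : M) : f (op s • m) = op s • f m :=
  f.map_smul_right' s m

@[ext]
theorem ext {f g : BimodHom R S M N} (h : ∀ m, f m = g m) : f = g := DFunLike.ext f g h

/-- The underlying left linear map. -/
def toLeft (f : BimodHom R S M N) : M →ₗ[R] N where
  toFun := f
  map_add' := f.map_add'
  map_smul' := f.map_smul_left'

/-- The underlying right linear map. -/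
def toRight (f : BimodHom R S M N) : M →ₗ[Sᵐᵒᵖ] N where
  toFun := f
  map_add' := f.map_add'
  map_smul' s m := f.map_smul_right' s.unop m

@[simp] theorem toLeft_apply (f : BimodHom R S M N) (m : M) : f.toLeft m = f m := rfl

@[simp] theorem toRight_apply (f : BimodHom R S M N) (m : M) : f.toRight m = f m := rfl

/-- The identity. -/
def id (R S : Type u) [Ring R] [Ring S] (M : Type u) [AddCommGroup M]
    [Module R M] [Module Sᵐᵒᵖ M] : BimodHom R S M M where
  toAddMonoidHom := AddMonoidHom.id M
  map_smul_left' _ _ := rfl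
  map_smul_right' _ _ := rfl

/-- Composition. -/
def comp (g : BimodHom R S N P) (f : BimodHom R S M N) : BimodHom R S M P where
  toAddMonoidHom := g.toAddMonoidHom.comp f.toAddMonoidHom
  map_smul_left' r m := by
    change g (f (r • m)) = r • g (f m)
    rw [map_smul_left, map_smul_left]
  map_smul_right' s m := by
    change g (f (op s • m)) = op s • g (f m)
    rw [map_smul_right, map_smul_right]

@[simp] theorem id_apply (m : M) : BimodHom.id R S M m = m := rfl

@[simp] theorem comp_apply (g : BimodHom R S N P) (f : BimodHom R S M N) (m : M) :
    g.comp f m = g (f m) := rfl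

end BimodHom

/-! ### Group corings -/

/-- A `G`-`A`-coring. The comultiplication `Δ_{α,β} : C_{αβ} → C_α ⊗_A C_β` is indexed by triples
`(α, β, γ)` with `α β = γ`, so that no transport along equalities such as `(αβ)γ = α(βγ)` is
needed. -/
structure GroupCoring (G A : Type u) [Group G] [Ring A] where
  X : G → Type u
  [addCommGroup : ∀ α, AddCommGroup (X α)]
  [leftModule : ∀ α, Module A (X α)]
  [rightModule : ∀ α, Module Aᵐᵒᵖ (X α)]
  [bimodule : ∀ α, SMulCommClass A Aᵐᵒᵖ (X α)]
  comul : ∀ (α β γ : G), α * β = γ → BimodHom A A (X γ) (BTensor A (X α) (X β))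
  counit : BimodHom A A (X 1) A
  /-- `(Δ_{α,β} ⊗ C_γ) ∘ Δ_{αβ,γ} = (C_α ⊗ Δ_{β,γ}) ∘ Δ_{α,βγ}` -/
  coassoc : ∀ (α β γ αβ βγ αβγ : G) (h₁ : α * β = αβ) (h₂ : β * γ = βγ) (h₃ : αβ * γ = αβγ)
    (h₄ : α * βγ = αβγ) (c : X αβγ),
    BTensor.assoc (BTensor.map (comul α β αβ h₁).toRight LinearMap.id (comul αβ γ αβγ h₃ c)) =
      BTensor.map LinearMap.id (comul β γ βγ h₂).toLeft (comul α βγ αβγ h₄ c)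
  /-- `(C_α ⊗ ε) ∘ Δ_{α,e} = C_α` -/
  right_counit : ∀ (α : G) (c : X α),
    BTensor.rid A (X α) (BTensor.map LinearMap.id counit.toLeft (comul α 1 α (mul_one α) c)) = c
  /-- `(ε ⊗ C_α) ∘ Δ_{e,α} = C_α` -/
  left_counit : ∀ (α : G) (c : X α),
    BTensor.lid A (X α) (BTensor.map counit.toRight LinearMap.id (comul 1 α α (one_mul α) c)) = c

attribute [instance] GroupCoring.addCommGroup GroupCoring.leftModule GroupCoring.rightModule
  GroupCoring.bimodule

namespace GroupCoring

variable {G A : Type u} [Group G] [Ring A]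

/-- A morphism of `G`-`A`-corings. -/
@[ext]
structure Hom (C D : GroupCoring G A) where
  app : ∀ α, BimodHom A A (C.X α) (D.X α)
  /-- `(f_α ⊗ f_β) ∘ Δ_{α,β} = Δ_{α,β} ∘ f_{αβ}` -/
  map_comul : ∀ (α β γ : G) (h : α * β = γ) (c : C.X γ),
    BTensor.map (app α).toRight (app β).toLeft (C.comul α β γ h c) = D.comul α β γ h (app γ c)
  /-- `ε ∘ f_e = ε` -/
  map_counit : ∀ c : C.X 1, D.counit (app 1 c) = C.counit c

instance : Category (GroupCoring G A) where
  Hom := Hom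
  id C :=
    { app := fun α => BimodHom.id A A (C.X α)
      map_comul := fun α β γ h c => BTensor.map_id_apply _
      map_counit := fun c => rfl }
  comp f g :=
    { app := fun α => (g.app α).comp (f.app α)
      map_comul := fun α β γ h c => by
        rw [BimodHom.comp_apply, ← g.map_comul, ← f.map_comul, BTensor.map_map]
        rfl
      map_counit := fun c => by
        rw [BimodHom.comp_apply, g.map_counit, f.map_counit] }

/-- A grouplike family `(x_α)` of a `G`-`A`-coring. -/
structure GrouplikeFamily (C : GroupCoring G A) where
  x : ∀ α, C.X α
  comul_x : ∀ (α β γ : G) (h : α * β = γ), C.comul α β γ h (x γ) = BTensor.tmul A (x α) (x β)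
  counit_x : C.counit (x 1) = 1

/-- The coinvariants `A^{co C} = {a ∈ A | a x_α = x_α a for all α}`, a subring of `A`. -/
def GrouplikeFamily.coinvariants {C : GroupCoring G A} (x : C.GrouplikeFamily) : Subring A where
  carrier := {a | ∀ α, a • x.x α = op a • x.x α}
  zero_mem' α := by simp
  one_mem' α := by simp
  add_mem' {a b} ha hb α := by
    rw [add_smul, ha α, hb α, MulOpposite.op_add, add_smul]
  mul_mem' {a b} ha hb α := by
    rw [mul_smul, hb α, smul_comm, ha α, smul_smul, MulOpposite.op_mul]
  neg_mem' {a} ha α := by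
    rw [neg_smul, ha α, MulOpposite.op_neg, neg_smul]

end GroupCoring

/-! ### Restriction of scalars along a ring morphism -/

section Restriction

variable {B A : Type u} [Ring B] [Ring A]

/-- `A` as a `(B, A)`-bimodule, via a ring morphism `f : B → A`. -/
def ResLeft (_f : B →+* A) : Type u := A

namespace ResLeft

variable (f : B →+* A)

/-- The identity map of `A`. -/
def of (a : A) : ResLeft f := a

/-- The underlying element of `A`. -/
def val (a : ResLeft f) : A := a

instance : AddCommGroup (ResLeft f) := inferInstanceAs (AddCommGroup A)

instance : Module B (ResLeft f) := Module.compHom A f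

instance : Module Aᵐᵒᵖ (ResLeft f) := inferInstanceAs (Module Aᵐᵒᵖ A)

instance : SMulCommClass B Aᵐᵒᵖ (ResLeft f) where
  smul_comm b a c := smul_comm (f b) a (c.val f)

theorem smul_of (b : B) (a : A) : b • of f a = of f (f b * a) := rfl

theorem op_smul_of (a' : A) (a : A) : op a' • of f a = of f (a * a') := rfl

end ResLeft

/-- `A` as an `(A, B)`-bimodule, via a ring morphism `f : B → A`. -/
def ResRight (_f : B →+* A) : Type u := A

namespace ResRight

variable (f : B →+* A)

/-- The element `a` of `A`, seen in the bimodule. -/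
def of (a : A) : ResRight f := a

/-- The underlying element of `A`. -/
def val (a : ResRight f) : A := a

instance : AddCommGroup (ResRight f) := inferInstanceAs (AddCommGroup A)

instance : Module A (ResRight f) := inferInstanceAs (Module A A)

instance : Module Bᵐᵒᵖ (ResRight f) := Module.compHom A f.op

instance : SMulCommClass A Bᵐᵒᵖ (ResRight f) where
  smul_comm a b c := smul_comm a (f.op b) (c.val f)

theorem smul_of (a' : A) (a : A) : a' • of f a = of f (a' * a) := rfl

theorem op_smul_of (b : B) (a : A) : op b • of f a = of f (a * f b) := rfl

end ResRight

end Restriction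

/-! ### The canonical coring and the Galois property -/

section Galois

variable {B A : Type u} [Ring B] [Ring A]

/-- The `A`-bimodule `A ⊗_B A`. -/
abbrev SweedlerModule (f : B →+* A) : Type u := BTensor B (ResRight f) (ResLeft f)

/-- The comultiplication `a ⊗ b ↦ (a ⊗ 1) ⊗ (1 ⊗ b)` of the Sweedler canonical coring. -/
def sweedlerComul (f : B →+* A) :
    BimodHom A A (SweedlerModule f) (BTensor A (SweedlerModule f) (SweedlerModule f)) where
  toAddMonoidHom := BTensor.lift₂ B
    (fun a b => BTensor.tmul A (BTensor.tmul B a (ResLeft.of f 1))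
      (BTensor.tmul B (ResRight.of f 1) b))
    (fun a a' b => by rw [BTensor.add_tmul, BTensor.add_tmul])
    (fun a b b' => by rw [BTensor.tmul_add, BTensor.tmul_add])
    (fun a r b => by
      have h1 : r • ResLeft.of f (1 : A) = op (f r) • ResLeft.of f 1 := by
        rw [ResLeft.smul_of, ResLeft.op_smul_of, mul_one, one_mul]
      have h2 : f r • ResRight.of f (1 : A) = op r • ResRight.of f 1 := by
        rw [ResRight.smul_of, ResRight.op_smul_of, mul_one, one_mul]
      rw [BTensor.smul_tmul, h1, ← BTensor.right_smul_tmul, BTensor.smul_tmul,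
        BTensor.left_smul_tmul, h2, BTensor.smul_tmul])
  map_smul_left' r t := by
    change BTensor.lift₂ B _ _ _ _ (r • t) = r • BTensor.lift₂ B _ _ _ _ t
    induction t using BTensor.induction with
    | tmul m n => rfl
    | add a b ha hb => rw [smul_add, map_add, ha, hb, map_add, smul_add]
  map_smul_right' s t := by
    change BTensor.lift₂ B _ _ _ _ (op s • t) = op s • BTensor.lift₂ B _ _ _ _ t
    induction t using BTensor.induction with
    | tmul m n => rfl
    | add a b ha hb => rw [smul_add, map_add, ha, hb, map_add, smul_add]

/-- The counit `a ⊗ b ↦ a b` of the Sweedler canonical coring. -/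
def sweedlerCounit (f : B →+* A) : BimodHom A A (SweedlerModule f) A where
  toAddMonoidHom := BTensor.lift₂ B (fun a b => a.val f * b.val f)
    (fun a a' b => add_mul (a.val f) (a'.val f) (b.val f))
    (fun a b b' => mul_add (a.val f) (b.val f) (b'.val f))
    (fun a r b => mul_assoc (a.val f) (f r) (b.val f))
  map_smul_left' r t := by
    change BTensor.lift₂ B _ _ _ _ (r • t) = r • BTensor.lift₂ B _ _ _ _ t
    induction t using BTensor.induction with
    | tmul m n => exact mul_assoc r (m.val f) (n.val f)
    | add a b ha hb => rw [smul_add, map_add, ha, hb, map_add, smul_add]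
  map_smul_right' s t := by
    change BTensor.lift₂ B _ _ _ _ (op s • t) = op s • BTensor.lift₂ B _ _ _ _ t
    induction t using BTensor.induction with
    | tmul m n => exact (mul_assoc (m.val f) (n.val f) s).symm
    | add a b ha hb => rw [smul_add, map_add, ha, hb, map_add, smul_add]

@[simp]
theorem sweedlerComul_tmul (f : B →+* A) (a : ResRight f) (b : ResLeft f) :
    sweedlerComul f (BTensor.tmul B a b) = BTensor.tmul A (BTensor.tmul B a (ResLeft.of f 1))
      (BTensor.tmul B (ResRight.of f 1) b) := rfl

@[simp]
theorem sweedlerCounit_tmul (f : B →+* A) (a : ResRight f) (b : ResLeft f) :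
    sweedlerCounit f (BTensor.tmul B a b) = a.val f * b.val f := rfl

variable (G : Type u) [Group G]

/-- The cofree `G`-`A`-coring `(A ⊗_B A)⟨G⟩` on the Sweedler canonical coring of `f : B → A`:
every component is a copy of `A ⊗_B A`, and every `Δ_{α,β}` is the comultiplication of
`A ⊗_B A`. -/
def sweedlerGroupCoring (f : B →+* A) : GroupCoring G A where
  X _ := SweedlerModule f
  comul _ _ _ _ := sweedlerComul f
  counit := sweedlerCounit f
  coassoc _ _ _ _ _ _ _ _ _ _ c := by
    induction c using BTensor.induction with
    | tmul m n => rfl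
    | add a b ha hb =>
      simp only [map_add, ha, hb]
  right_counit _ c := by
    induction c using BTensor.induction with
    | tmul m n =>
      have h : op ((ResRight.of f (1 : A)).val f * n.val f) • ResLeft.of f (1 : A) = n :=
        (one_mul (1 * n.val f)).trans (one_mul _)
      simp only [sweedlerComul_tmul, BTensor.map_tmul, BTensor.rid_tmul, LinearMap.id_apply,
        BimodHom.toLeft_apply, sweedlerCounit_tmul, BTensor.right_smul_tmul, h]
    | add a b ha hb =>
      simp only [map_add, ha, hb]
  left_counit _ c := by
    induction c using BTensor.induction with
    | tmul m n =>
      have h : (m.val f * (ResLeft.of f (1 : A)).val f) • ResRight.of f (1 : A) = m :=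
        (mul_one (m.val f * 1)).trans (mul_one _)
      simp only [sweedlerComul_tmul, BTensor.map_tmul, BTensor.lid_tmul, LinearMap.id_apply,
        BimodHom.toRight_apply, sweedlerCounit_tmul, BTensor.left_smul_tmul, h]
    | add a b ha hb =>
      simp only [map_add, ha, hb]

variable {G}
variable {C : GroupCoring G A} (x : C.GrouplikeFamily)

/-- The map `can_α : A ⊗_T A → C_α`, `a ⊗ b ↦ a x_α b`, where `T = A^{co C}`. -/
def canApp (α : G) : BimodHom A A (SweedlerModule x.coinvariants.subtype) (C.X α) where
  toAddMonoidHom := BTensor.lift₂ x.coinvariants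
    (fun a b => a.val _ • op (b.val _) • x.x α)
    (fun a a' b => add_smul _ _ _)
    (fun a b b' => by
      change a.val _ • op (b.val _ + b'.val _) • x.x α = _
      rw [MulOpposite.op_add, add_smul, smul_add])
    (fun a t b => by
      change (a.val _ * (t : A)) • op (b.val _) • x.x α =
        a.val _ • op ((t : A) * b.val _) • x.x α
      rw [mul_smul, smul_comm (t : A), t.2 α, smul_smul (op (b.val _)), MulOpposite.op_mul])
  map_smul_left' r t := by
    change BTensor.lift₂ _ _ _ _ _ (r • t) = r • BTensor.lift₂ _ _ _ _ _ t
    induction t using BTensor.induction with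
    | tmul m n => exact mul_smul r (m.val _) _
    | add a b ha hb => rw [smul_add, map_add, ha, hb, map_add, smul_add]
  map_smul_right' s t := by
    change BTensor.lift₂ _ _ _ _ _ (op s • t) = op s • BTensor.lift₂ _ _ _ _ _ t
    induction t using BTensor.induction with
    | tmul m n =>
      change m.val _ • op (n.val _ * s) • x.x α = op s • m.val _ • op (n.val _) • x.x α
      rw [MulOpposite.op_mul, mul_smul, smul_comm (m.val _) (op s)]
    | add a b ha hb => rw [smul_add, map_add, ha, hb, map_add, smul_add]

/-- The canonical morphism of `G`-`A`-corings `can : (A ⊗_T A)⟨G⟩ → C`, where `T = A^{co C}`. -/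
def can : sweedlerGroupCoring G x.coinvariants.subtype ⟶ C where
  app α := canApp x α
  map_comul α β γ h c := by
    change BTensor.map (canApp x α).toRight (canApp x β).toLeft
      (sweedlerComul x.coinvariants.subtype c) = C.comul α β γ h (canApp x γ c)
    induction c using BTensor.induction with
    | tmul m n =>
      have e1 : canApp x α (BTensor.tmul _ m (ResLeft.of _ 1)) = m.val _ • x.x α := by
        change m.val _ • op (1 : A) • x.x α = _
        simp
      have e2 : canApp x β (BTensor.tmul _ (ResRight.of _ 1) n) = op (n.val _) • x.x β := by
        change (1 : A) • op (n.val _) • x.x β = _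
        simp
      have e3 : canApp x γ (BTensor.tmul _ m n) = m.val _ • op (n.val _) • x.x γ := rfl
      simp only [BimodHom.toLeft_apply, sweedlerComul_tmul, BTensor.map_tmul,
        BimodHom.toRight_apply, e1, e2, e3]
      rw [BimodHom.map_smul_left, BimodHom.map_smul_right, x.comul_x]
      rfl
    | add a b ha hb => simp only [map_add, ha, hb]
  map_counit c := by
    change C.counit (canApp x 1 c) = sweedlerCounit x.coinvariants.subtype c
    induction c using BTensor.induction with
    | tmul m n =>
      have e3 : canApp x 1 (BTensor.tmul _ m n) = m.val _ • op (n.val _) • x.x 1 := rfl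
      simp only [e3, sweedlerCounit_tmul]
      rw [BimodHom.map_smul_left, BimodHom.map_smul_right, x.counit_x]
      change m.val _ * (1 * n.val _) = _
      rw [one_mul]
    | add a b ha hb => simp only [map_add, ha, hb]

/-- `(C, x)` is a Galois group coring if `can` is an isomorphism of group corings. -/
def IsGaloisGroupCoring : Prop := IsIso (can x)

end Galois

/-! ### Comodules -/

section Comodules

variable {G A : Type u} [Group G] [Ring A]

/-- A right `C`-comodule. -/
structure Comodule (C : GroupCoring G A) where
  X : Type u
  [addCommGroup : AddCommGroup X]
  [module : Module Aᵐᵒᵖ X]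
  coact : ∀ α, X →ₗ[Aᵐᵒᵖ] BTensor A X (C.X α)
  /-- `(M ⊗ Δ_{α,β}) ∘ ρ_{αβ} = (ρ_α ⊗ C_β) ∘ ρ_β` -/
  coassoc : ∀ (α β γ : G) (h : α * β = γ) (m : X),
    BTensor.map LinearMap.id (C.comul α β γ h).toLeft (coact γ m) =
      BTensor.assoc (BTensor.map (coact α) LinearMap.id (coact β m))
  /-- `(M ⊗ ε) ∘ ρ_e = M` -/
  counit : ∀ m : X, BTensor.rid A X (BTensor.map LinearMap.id C.counit.toLeft (coact 1 m)) = m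

attribute [instance] Comodule.addCommGroup Comodule.module

namespace Comodule

/-- A morphism of right `C`-comodules. -/
@[ext]
structure Hom {C : GroupCoring G A} (M N : Comodule C) where
  app : M.X →ₗ[Aᵐᵒᵖ] N.X
  /-- `(f ⊗ C_α) ∘ ρ_α = ρ_α ∘ f` -/
  comm : ∀ (α : G) (m : M.X), BTensor.map app LinearMap.id (M.coact α m) = N.coact α (app m)

instance (C : GroupCoring G A) : Category (Comodule C) where
  Hom := Hom
  id M :=
    { app := LinearMap.id
      comm := fun α m => BTensor.map_id_apply _ }
  comp f g :=
    { app := g.app ∘ₗ f.app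
      comm := fun α m => by
        rw [LinearMap.comp_apply, ← g.comm, ← f.comm, BTensor.map_map]
        rfl }

end Comodule

/-- A right `G`-`C`-comodule. The coaction `ρ_{α,β} : M_{αβ} → M_α ⊗_A C_β` is indexed by triples
`(α, β, γ)` with `α β = γ`. -/
structure GComodule (C : GroupCoring G A) where
  X : G → Type u
  [addCommGroup : ∀ α, AddCommGroup (X α)]
  [module : ∀ α, Module Aᵐᵒᵖ (X α)]
  coact : ∀ (α β γ : G), α * β = γ → (X γ →ₗ[Aᵐᵒᵖ] BTensor A (X α) (C.X β))
  /-- `(M_α ⊗ Δ_{β,γ}) ∘ ρ_{α,βγ} = (ρ_{α,β} ⊗ C_γ) ∘ ρ_{αβ,γ}` -/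
  coassoc : ∀ (α β γ αβ βγ αβγ : G) (h₁ : α * β = αβ) (h₂ : β * γ = βγ) (h₃ : αβ * γ = αβγ)
    (h₄ : α * βγ = αβγ) (m : X αβγ),
    BTensor.map LinearMap.id (C.comul β γ βγ h₂).toLeft (coact α βγ αβγ h₄ m) =
      BTensor.assoc (BTensor.map (coact α β αβ h₁) LinearMap.id (coact αβ γ αβγ h₃ m))
  /-- `(M_α ⊗ ε) ∘ ρ_{α,e} = M_α` -/
  counit : ∀ (α : G) (m : X α), BTensor.rid A (X α)
    (BTensor.map LinearMap.id C.counit.toLeft (coact α 1 α (mul_one α) m)) = m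

attribute [instance] GComodule.addCommGroup GComodule.module

namespace GComodule

/-- A morphism of right `G`-`C`-comodules. -/
@[ext]
structure Hom {C : GroupCoring G A} (M N : GComodule C) where
  app : ∀ α, M.X α →ₗ[Aᵐᵒᵖ] N.X α
  /-- `(f_α ⊗ C_β) ∘ ρ_{α,β} = ρ_{α,β} ∘ f_{αβ}` -/
  comm : ∀ (α β γ : G) (h : α * β = γ) (m : M.X γ),
    BTensor.map (app α) LinearMap.id (M.coact α β γ h m) = N.coact α β γ h (app γ m)

instance (C : GroupCoring G A) : Category (GComodule C) where
  Hom := Hom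
  id M :=
    { app := fun α => LinearMap.id
      comm := fun α β γ h m => BTensor.map_id_apply _ }
  comp f g :=
    { app := fun α => g.app α ∘ₗ f.app α
      comm := fun α β γ h m => by
        rw [LinearMap.comp_apply, ← g.comm, ← f.comm, BTensor.map_map]
        rfl }

end GComodule

/-- The functor `G₁` from `C`-comodules to `G`-`C`-comodules: `G₁(M)_α = M` for all `α`, with
coaction `ρ_{α,β} = ρ_β`. -/
def functorG1 (C : GroupCoring G A) : Comodule C ⥤ GComodule C where
  obj M :=
    { X := fun _ => M.X
      coact := fun _ β _ _ => M.coact β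
      coassoc := fun _ β γ _ βγ _ _ h₂ _ _ m => M.coassoc β γ βγ h₂ m
      counit := fun _ m => M.counit m }
  map f :=
    { app := fun _ => f.app
      comm := fun _ β _ _ m => f.comm β m }

end Comodules

/-! ### The induction functor and the coinvariants functor -/

section Functors

variable {G A B : Type u} [Group G] [Ring A] [Ring B]
variable {C : GroupCoring G A} (x : C.GrouplikeFamily) (i : B →+* x.coinvariants)

/-- The composite ring morphism `B → A^{co C} → A`. -/
abbrev toA : B →+* A := x.coinvariants.subtype.comp i

/-- `A` as a left `B`-module (and right `A`-module). -/
abbrev leftA : Type u := ResLeft (toA x i)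

/-- The right `A`-module `N ⊗_B A`. -/
abbrev Ind (N : Type u) [AddCommGroup N] [Module Bᵐᵒᵖ N] : Type u := BTensor B N (leftA x i)

section

variable (N : Type u) [AddCommGroup N] [Module Bᵐᵒᵖ N]

/-- The coaction `n ⊗ a ↦ (n ⊗ 1) ⊗ x_α a` on `N ⊗_B A`. -/
def indCoact (α : G) : Ind x i N →ₗ[Aᵐᵒᵖ] BTensor A (Ind x i N) (C.X α) where
  toFun := BTensor.lift₂ B
    (fun n a => BTensor.tmul A (BTensor.tmul B n (ResLeft.of (toA x i) 1))
      (op (a.val (toA x i)) • x.x α))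
    (fun n n' a => by rw [BTensor.add_tmul, BTensor.add_tmul])
    (fun n a a' => by
      rw [← BTensor.tmul_add, ← add_smul]
      rfl)
    (fun n b a => by
      have h1 : b • ResLeft.of (toA x i) (1 : A) = op (toA x i b) • ResLeft.of (toA x i) 1 := by
        rw [ResLeft.smul_of, ResLeft.op_smul_of, mul_one, one_mul]
      have h2 : toA x i b • op (a.val (toA x i)) • x.x α =
          op ((b • a).val (toA x i)) • x.x α := by
        have h3 : (toA x i b) • x.x α = op (toA x i b) • x.x α := (i b).2 α
        rw [smul_comm, h3, smul_smul, ← MulOpposite.op_mul]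
        rfl
      rw [BTensor.smul_tmul B n, h1, ← BTensor.right_smul_tmul (op (toA x i b)) n,
        BTensor.smul_tmul, h2])
  map_add' := map_add _
  map_smul' s t := by
    induction t using BTensor.induction with
    | tmul n a =>
      change BTensor.tmul A _ (op (a.val (toA x i) * s.unop) • x.x α) =
        BTensor.tmul A _ (s • op (a.val (toA x i)) • x.x α)
      rw [smul_smul]
      rfl
    | add a b ha hb => rw [smul_add, map_add, ha, hb, map_add, smul_add]

@[simp]
theorem indCoact_tmul (α : G) (n : N) (a : leftA x i) :
    indCoact x i N α (BTensor.tmul B n a) =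
      BTensor.tmul A (BTensor.tmul B n (ResLeft.of (toA x i) 1))
        (op (a.val (toA x i)) • x.x α) := rfl

end

/-- The right `C`-comodule `N ⊗_B A`. -/
def indComodule (N : Type u) [AddCommGroup N] [Module Bᵐᵒᵖ N] : Comodule C where
  X := Ind x i N
  coact := indCoact x i N
  coassoc α β γ h t := by
    induction t using BTensor.induction with
    | tmul n a =>
      have e : (C.comul α β γ h) (op (a.val (toA x i)) • x.x γ) =
          BTensor.tmul A (x.x α) (op (a.val (toA x i)) • x.x β) := by
        rw [BimodHom.map_smul_right, x.comul_x]
        rfl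
      have e1 : op ((ResLeft.of (toA x i) (1 : A)).val (toA x i)) • x.x α = x.x α :=
        one_smul _ _
      simp only [indCoact_tmul, BTensor.map_tmul, LinearMap.id_apply, BimodHom.toLeft_apply,
        e, e1, BTensor.assoc_tmul]
    | add a b ha hb => simp only [map_add, ha, hb]
  counit t := by
    induction t using BTensor.induction with
    | tmul n a =>
      have e : C.counit (op (a.val (toA x i)) • x.x 1) = a.val (toA x i) := by
        rw [BimodHom.map_smul_right, x.counit_x]
        exact one_mul _
      simp only [indCoact_tmul, BTensor.map_tmul, LinearMap.id_apply, BimodHom.toLeft_apply,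
        e, BTensor.rid_tmul, BTensor.right_smul_tmul]
      exact congrArg _ (one_mul (a.val (toA x i)))
    | add a b ha hb => simp only [map_add, ha, hb]

/-- The morphism `g ⊗_B A` of right `C`-comodules. -/
def indMap {N N' : Type u} [AddCommGroup N] [Module Bᵐᵒᵖ N] [AddCommGroup N'] [Module Bᵐᵒᵖ N']
    (g : N →ₗ[Bᵐᵒᵖ] N') : indComodule x i N ⟶ indComodule x i N' where
  app := BTensor.rTensor (S := A) (N := leftA x i) g
  comm α := by
    refine DFunLike.congr_fun (BTensor.addHom_ext
      (f := (BTensor.map (BTensor.rTensor (S := A) (N := leftA x i) g) LinearMap.id).comp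
        (indCoact x i N α).toAddMonoidHom)
      (g := (indCoact x i N' α).toAddMonoidHom.comp
        (BTensor.rTensor (S := A) (N := leftA x i) g).toAddMonoidHom) ?_)
    exact fun n a => rfl

/-- The functor `F₆ = - ⊗_B A` from right `B`-modules to right `C`-comodules. -/
def functorF6 : ModuleCat.{u} Bᵐᵒᵖ ⥤ Comodule C where
  obj N := indComodule x i N
  map g := indMap x i g.hom
  map_id _ := Comodule.Hom.ext (LinearMap.ext fun t => BTensor.map_id_apply (R := B) t)
  map_comp f g := Comodule.Hom.ext (LinearMap.ext fun t =>
    (BTensor.map_map (R := B) (N := leftA x i) (N' := leftA x i) (N'' := leftA x i)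
      g.hom LinearMap.id f.hom LinearMap.id t).symm)

/-- The functor `F₇ = G₁ ∘ F₆` from right `B`-modules to right `G`-`C`-comodules. -/
def functorF7 : ModuleCat.{u} Bᵐᵒᵖ ⥤ GComodule C := functorF6 x i ⋙ functorG1 C

/-- The coinvariants `M^{co C}` of a `G`-`C`-comodule `M`: the families `(m_α) ∈ ∏ M_α` with
`ρ_{α,β}(m_{αβ}) = m_α ⊗ x_β` for all `α, β`. -/
def coinvSubgroup (M : GComodule C) : AddSubgroup (∀ α, M.X α) where
  carrier := {m | ∀ (α β γ : G) (h : α * β = γ),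
    M.coact α β γ h (m γ) = BTensor.tmul A (m α) (x.x β)}
  zero_mem' α β γ h := by
    have := BTensor.add_tmul A (0 : M.X α) 0 (x.x β)
    rw [add_zero, left_eq_add] at this
    simp [this]
  add_mem' {m m'} hm hm' α β γ h := by
    simp only [Pi.add_apply, map_add, hm α β γ h, hm' α β γ h, BTensor.add_tmul]
  neg_mem' {m} hm α β γ h := by
    have h0 := BTensor.add_tmul A (0 : M.X α) 0 (x.x β)
    rw [add_zero, left_eq_add] at h0
    have h1 := BTensor.add_tmul A (m α) (-m α) (x.x β)
    rw [add_neg_cancel, h0] at h1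
    rw [Pi.neg_apply, map_neg, hm α β γ h]
    exact neg_eq_of_add_eq_zero_right h1.symm

/-- `M^{co C}` as a right `B`-module, via `i : B → A^{co C}`. -/
def Coinv (_i : B →+* x.coinvariants) (M : GComodule C) : Type u := coinvSubgroup x M

instance (M : GComodule C) : AddCommGroup (Coinv x i M) :=
  inferInstanceAs (AddCommGroup (coinvSubgroup x M))

variable {x i} in
/-- The component `m_α` of a family `(m_α)` of coinvariants. -/
def Coinv.component {M : GComodule C} (m : Coinv x i M) (α : G) : M.X α :=
  (Subtype.val m : ∀ α, M.X α) α

variable {x i} in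
theorem Coinv.coact_component {M : GComodule C} (m : Coinv x i M) (α β γ : G) (h : α * β = γ) :
    M.coact α β γ h (m.component γ) = BTensor.tmul A (m.component α) (x.x β) :=
  m.2 α β γ h

/-- Constructor for coinvariants. -/
def Coinv.mk {M : GComodule C} (m : ∀ α, M.X α) (hm : ∀ (α β γ : G) (h : α * β = γ),
    M.coact α β γ h (m γ) = BTensor.tmul A (m α) (x.x β)) : Coinv x i M :=
  (⟨m, hm⟩ : coinvSubgroup x M)

@[simp]
theorem Coinv.component_mk {M : GComodule C} (m : ∀ α, M.X α) (hm) (α : G) :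
    (Coinv.mk x i m hm).component α = m α := rfl

variable {x i} in
@[ext]
theorem Coinv.ext {M : GComodule C} {m m' : Coinv x i M}
    (h : ∀ α, m.component α = m'.component α) : m = m' :=
  Subtype.ext (funext h)

/-- The right action `(m_α) b = (m_α b)`. -/
instance (M : GComodule C) : Module Bᵐᵒᵖ (Coinv x i M) where
  smul b m := Coinv.mk x i (fun α => op (toA x i b.unop) • m.component α) fun α β γ h => by
    have h3 : (toA x i b.unop) • x.x β = op (toA x i b.unop) • x.x β := (i b.unop).2 β
    rw [map_smul, m.coact_component α β γ h, BTensor.smul_tmul, h3]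
    rfl
  one_smul m := Coinv.ext fun α => by
    change op (toA x i 1) • m.component α = m.component α
    rw [map_one, op_one, one_smul]
  mul_smul b b' m := Coinv.ext fun α => by
    change op (toA x i (b'.unop * b.unop)) • m.component α =
      op (toA x i b.unop) • op (toA x i b'.unop) • m.component α
    rw [map_mul, MulOpposite.op_mul, mul_smul]
  smul_zero b := Coinv.ext fun α => smul_zero (op (toA x i b.unop))
  smul_add b m m' := Coinv.ext fun α =>
    smul_add (op (toA x i b.unop)) (m.component α) (m'.component α)
  add_smul b b' m := Coinv.ext fun α => by
    change op (toA x i (b.unop + b'.unop)) • m.component α =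
      op (toA x i b.unop) • m.component α + op (toA x i b'.unop) • m.component α
    rw [map_add, MulOpposite.op_add, add_smul]
  zero_smul m := Coinv.ext fun α => by
    change op (toA x i 0) • m.component α = 0
    rw [map_zero, MulOpposite.op_zero, zero_smul]

theorem Coinv.component_op_smul {M : GComodule C} (m : Coinv x i M) (b : B) (α : G) :
    (op b • m).component α = op (toA x i b) • m.component α := rfl

/-- The restriction of a morphism `(f_α)` of `G`-`C`-comodules to the coinvariants. -/
def Coinv.map {M N : GComodule C} (f : M ⟶ N) : Coinv x i M →ₗ[Bᵐᵒᵖ] Coinv x i N where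
  toFun m := Coinv.mk x i (fun α => f.app α (m.component α)) fun α β γ h => by
    rw [← f.comm, m.coact_component α β γ h]
    rfl
  map_add' m m' := Coinv.ext fun α => map_add (f.app α) (m.component α) (m'.component α)
  map_smul' b m := Coinv.ext fun α =>
    map_smul (f.app α) (op (toA x i b.unop)) (m.component α)

/-- The functor `G₇ = (-)^{co C}` from right `G`-`C`-comodules to right `B`-modules. -/
def functorG7 : GComodule C ⥤ ModuleCat.{u} Bᵐᵒᵖ where
  obj M := ModuleCat.of Bᵐᵒᵖ (Coinv x i M)
  map f := ModuleCat.ofHom (Coinv.map x i f)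

/-- The map `n ↦ (n ⊗ 1)_α` from `N` to `F₇(N)^{co C}`. -/
def unitLinear (N : Type u) [AddCommGroup N] [Module Bᵐᵒᵖ N] :
    N →ₗ[Bᵐᵒᵖ] Coinv x i ((functorG1 C).obj (indComodule x i N)) where
  toFun n := Coinv.mk x i (M := (functorG1 C).obj (indComodule x i N))
    (fun _ => BTensor.tmul B n (ResLeft.of (toA x i) 1)) fun α β γ h => by
      have e1 : op ((ResLeft.of (toA x i) (1 : A)).val (toA x i)) • x.x β = x.x β :=
        one_smul _ _
      change indCoact x i N β _ = _
      rw [indCoact_tmul, e1]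
      rfl
  map_add' n n' := Coinv.ext fun α => BTensor.add_tmul B n n' _
  map_smul' b n := Coinv.ext fun α => by
    change BTensor.tmul B (op b.unop • n) (ResLeft.of (toA x i) 1) =
      BTensor.tmul B n (op (toA x i b.unop) • ResLeft.of (toA x i) 1)
    rw [BTensor.smul_tmul, ResLeft.smul_of, ResLeft.op_smul_of, mul_one, one_mul]

/-- The map `(m_β)_β ⊗ a ↦ m_α a` from `M^{co C} ⊗_B A` to `M_α`. -/
def counitLinear (M : GComodule C) (α : G) : Ind x i (Coinv x i M) →ₗ[Aᵐᵒᵖ] M.X α where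
  toFun := BTensor.lift₂ B
    (fun m a => op (a.val (toA x i)) • m.component α)
    (fun m m' a => smul_add _ (m.component α) (m'.component α))
    (fun m a a' =>
      add_smul (op (a.val (toA x i))) (op (a'.val (toA x i))) (m.component α))
    (fun m b a => (mul_smul (op (a.val (toA x i))) (op (toA x i b)) (m.component α)).symm)
  map_add' := map_add _
  map_smul' s t := by
    induction t using BTensor.induction with
    | tmul m a => exact mul_smul s (op (a.val (toA x i))) (m.component α)
    | add a b ha hb => rw [smul_add, map_add, ha, hb, map_add, smul_add]

@[simp]
theorem counitLinear_tmul (M : GComodule C) (α : G) (m : Coinv x i M) (a : leftA x i) :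
    counitLinear x i M α (BTensor.tmul B m a) = op (a.val (toA x i)) • m.component α := rfl

/-- The morphism `F₇(M^{co C}) → M` of `G`-`C`-comodules with components `counitLinear`. -/
def counitHom (M : GComodule C) :
    (functorG1 C).obj (indComodule x i (Coinv x i M)) ⟶ M where
  app α := counitLinear x i M α
  comm α β γ h := by
    refine DFunLike.congr_fun (BTensor.addHom_ext
      (f := (BTensor.map (counitLinear x i M α) LinearMap.id).comp
        (indCoact x i (Coinv x i M) β).toAddMonoidHom)
      (g := (M.coact α β γ h).toAddMonoidHom.comp (counitLinear x i M γ).toAddMonoidHom) ?_)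
    intro m a
    change BTensor.tmul A (op (1 : A) • m.component α) (op (a.val (toA x i)) • x.x β) =
      M.coact α β γ h (op (a.val (toA x i)) • m.component γ)
    rw [op_one, one_smul, map_smul, m.coact_component α β γ h, BTensor.right_smul_tmul]

/-- The adjunction `F₇ ⊣ G₇` between right `B`-modules and right `G`-`C`-comodules, with unit
`n ↦ (n ⊗ 1)_α` and counit `(m_β)_β ⊗ a ↦ m_α a`. -/
def adjunction7 : functorF7 x i ⊣ functorG7 x i where
  unit :=
    { app := fun N => ModuleCat.ofHom (unitLinear x i N)
      naturality := fun _ _ _ => rfl }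
  counit :=
    { app := fun M => counitHom x i M
      naturality := fun M N f => by
        apply GComodule.Hom.ext
        funext α
        refine BTensor.linearMap_ext A (M := Coinv x i M) (N := leftA x i) (P := N.X α) ?_
        exact fun m a => (map_smul (f.app α) (op (a.val (toA x i))) (m.component α)).symm }
  left_triangle_components N := by
    apply GComodule.Hom.ext
    funext α
    refine BTensor.linearMap_ext A (M := N) (N := leftA x i) (P := Ind x i N) ?_
    exact fun n a => congrArg (BTensor.tmul B n) (one_mul (a.val (toA x i)))
  right_triangle_components M := by
    apply ModuleCat.hom_ext
    refine LinearMap.ext fun (m : Coinv x i M) => ?_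
    exact Coinv.ext fun α => one_smul Aᵐᵒᵖ (m.component α)

end Functors

/-!
Write `σ : M ⊗_B A → M ⊗_A C_β`, `m ⊗ a ↦ m ⊗ x_β a` (`tensorGrouplike`). If `i` is bijective, the
Galois property says that `A ⊗_B A → C_β`, `a ⊗ b ↦ a x_β b`, is bijective for every `β`, and then
`σ` is bijective for every right `A`-module `M`. This turns a `G`-`C`-comodule into a family of
descent data along `B → A`, and the theorem becomes faithfully flat descent.

From the Galois property and flatness to the counit: an element `m ∈ M_γ` with
`ρ_{γ,e}(m) = m ⊗ x_e` extends uniquely to a family of coinvariants, by coassociativity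
(`exists_coinv_component_eq`, `coinv_component_injective`). So `M^{co C}` is, through its component
at `γ`, the kernel of `ρ_{γ,e} - (- ⊗ x_e)` on `M_γ`, and as `A` is flat, `M^{co C} ⊗_B A` is the
kernel of the induced map on `M_γ ⊗_B A ≅ M_γ ⊗_A C_e`. By coassociativity this kernel contains the
image of the injective map `ρ_{γ,e}`, whence the counit `M^{co C} ⊗_B A → M_γ` is bijective
(`counitLinear_bijective`). For the unit `η`, a triangle identity shows that `η_N ⊗_B A` is inverse
to a bijective counit map, and faithful flatness makes `η_N` bijective (`unitLinear_bijective`).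

For the converse, bijectivity of `η_B` gives that of `i` (`bijective_of_unitLinear`), and
injectivity of `η_N` gives `N = 0` if `N ⊗_B A = 0`. The coring `C` is a comodule over itself, with
coinvariants `{(a x_α)_α} ≅ A` (`regularCoinv_bijective`), so that the counit at `C` is the map
`a ⊗ b ↦ a x_α b`, and `C` is Galois (`baseCan_bijective_of_counitLinear`).
-/

/-! ### Flatness and exactness for tensor products over a noncommutative ring -/

namespace BTensor

variable {R : Type u} [Ring R] {M M' M'' P : Type u}
  [AddCommGroup M] [Module Rᵐᵒᵖ M] [AddCommGroup M'] [Module Rᵐᵒᵖ M']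
  [AddCommGroup M''] [Module Rᵐᵒᵖ M''] [AddCommGroup P] [Module R P]

theorem zero_tmul (p : P) : tmul R (0 : M) p = 0 := by
  have h := add_tmul R (0 : M) 0 p
  rwa [add_zero, left_eq_add] at h

theorem sub_tmul (m m' : M) (p : P) : tmul R (m - m') p = tmul R m p - tmul R m' p := by
  rw [eq_sub_iff_add_eq, ← add_tmul, sub_add_cancel]

/-- Right exactness of `- ⊗_R P`: if `M → M' → M'' → 0` is exact, then the kernel of
`M' ⊗_R P → M'' ⊗_R P` is contained in the image of `M ⊗_R P`. -/
theorem exists_map_eq_of_surjective (f : M →ₗ[Rᵐᵒᵖ] M') (g : M' →ₗ[Rᵐᵒᵖ] M'')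
    (hg : Function.Surjective g) (hfg : ∀ m, g m = 0 → ∃ k, f k = m) (t : BTensor R M' P)
    (ht : map g LinearMap.id t = 0) :
    ∃ s : BTensor R M P, map f LinearMap.id s = t := by
  let I : AddSubgroup (BTensor R M' P) := (map f (LinearMap.id : P →ₗ[R] P)).range
  -- Preimages under `g` may be chosen arbitrarily once the image of `M ⊗ P` is divided out.
  have key : ∀ m m' p, g m = g m' →
      (QuotientAddGroup.mk (tmul R m p) : BTensor R M' P ⧸ I) =
        QuotientAddGroup.mk (tmul R m' p) := by
    intro m m' p h
    obtain ⟨k, hk⟩ := hfg (m - m') (by rw [map_sub, h, sub_self])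
    rw [← sub_eq_zero, ← QuotientAddGroup.mk_sub, ← sub_tmul, ← hk]
    exact (QuotientAddGroup.eq_zero_iff _).2 ⟨tmul R k p, rfl⟩
  let c := Function.surjInv hg
  have hc : ∀ m, g (c m) = m := Function.surjInv_eq hg
  let ψ : BTensor R M'' P →+ BTensor R M' P ⧸ I :=
    lift₂ R (fun m p => QuotientAddGroup.mk (tmul R (c m) p))
      (fun m m' p => by
        rw [← QuotientAddGroup.mk_add, ← add_tmul]
        exact key _ _ _ (by rw [map_add, hc, hc, hc]))
      (fun m p p' => by rw [tmul_add, QuotientAddGroup.mk_add])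
      (fun m r p => by
        rw [← smul_tmul]
        exact key _ _ _ (by rw [map_smul, hc, hc]))
  have hψ : ψ.comp (map g LinearMap.id) = QuotientAddGroup.mk' I :=
    addHom_ext fun m p => key _ _ _ (hc _)
  have h0 := DFunLike.congr_fun hψ t
  rw [AddMonoidHom.comp_apply, ht, map_zero] at h0
  exact (QuotientAddGroup.eq_zero_iff _).1 h0.symm

/-- Tensoring with a flat module preserves exactness of `M → M' → M''` at `M'`. -/
theorem exists_map_eq_of_isLeftFlat (hP : IsLeftFlat R P) (f : M →ₗ[Rᵐᵒᵖ] M')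
    (g : M' →ₗ[Rᵐᵒᵖ] M'') (hfg : ∀ m, g m = 0 → ∃ k, f k = m) (t : BTensor R M' P)
    (ht : map g LinearMap.id t = 0) :
    ∃ s : BTensor R M P, map f LinearMap.id s = t := by
  let K := LinearMap.ker g
  refine exists_map_eq_of_surjective f K.mkQ K.mkQ_surjective
    (fun m hm => hfg m ((Submodule.Quotient.mk_eq_zero K).1 hm)) t ?_
  refine hP _ _ (K.liftQ g le_rfl) (LinearMap.ker_eq_bot.1 (Submodule.ker_liftQ_eq_bot _ _ _
    le_rfl)) ?_
  rw [map_map, map_zero, ← ht]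
  rfl

/-- A map that becomes bijective after tensoring with a faithfully flat module is bijective. -/
theorem bijective_of_map_bijective (hP : IsLeftFaithfullyFlat R P) (f : M →ₗ[Rᵐᵒᵖ] M')
    (hf : Function.Bijective (map f (LinearMap.id : P →ₗ[R] P))) : Function.Bijective f := by
  have hzero : ∀ {N N' : Type u} [AddCommGroup N] [Module Rᵐᵒᵖ N] [AddCommGroup N']
      [Module Rᵐᵒᵖ N'] (t : BTensor R N P),
      map (0 : N →ₗ[Rᵐᵒᵖ] N') (LinearMap.id : P →ₗ[R] P) t = 0 := fun t => by
    induction t using induction with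
    | tmul m p => exact zero_tmul p
    | add a b ha hb => rw [map_add, ha, hb, add_zero]
  constructor
  · let K := LinearMap.ker f
    have : Subsingleton K := hP.2 K <| subsingleton_of_forall_eq 0 fun t => by
      refine hP.1 _ _ K.subtype K.injective_subtype (hf.1 ?_)
      rw [map_map, map_zero, map_zero, LinearMap.comp_ker_subtype]
      exact hzero t
    exact LinearMap.ker_eq_bot.1 ((Submodule.subsingleton_iff_eq_bot).1 this)
  · let I := LinearMap.range f
    have : Subsingleton (M' ⧸ I) := hP.2 (M' ⧸ I) <| subsingleton_of_forall_eq 0 fun t => by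
      induction t using induction with
      | tmul q p =>
        obtain ⟨m, rfl⟩ := I.mkQ_surjective q
        obtain ⟨s, hs⟩ := hf.2 (tmul R m p)
        change map I.mkQ LinearMap.id (tmul R m p) = 0
        rw [← hs, map_map, LinearMap.range_mkQ_comp]
        exact hzero s
      | add a b ha hb => rw [ha, hb, add_zero]
    exact LinearMap.range_eq_top.1 (Submodule.Quotient.subsingleton_iff.1 this)

end BTensor

/-! ### Isomorphisms of group corings and of comodules -/

section Isomorphisms

variable {G A : Type u} [Group G] [Ring A]

theorem GroupCoring.isIso_iff_bijective {C D : GroupCoring G A} (f : C ⟶ D) :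
    IsIso f ↔ ∀ α, Function.Bijective (f.app α) := by
  constructor
  · intro _ α
    have h1 : ∀ c, (inv f).app α (f.app α c) = c := fun c =>
      DFunLike.congr_fun (congrFun (congrArg GroupCoring.Hom.app (IsIso.hom_inv_id f)) α) c
    have h2 : ∀ d, f.app α ((inv f).app α d) = d := fun d =>
      DFunLike.congr_fun (congrFun (congrArg GroupCoring.Hom.app (IsIso.inv_hom_id f)) α) d
    exact ⟨Function.LeftInverse.injective h1, Function.RightInverse.surjective h2⟩
  · intro h
    let e α : C.X α ≃+ D.X α := AddEquiv.ofBijective (f.app α) (h α)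
    let g α : BimodHom A A (D.X α) (C.X α) :=
      { toAddMonoidHom := (e α).symm
        map_smul_left' := fun r d => (h α).1 <| by
          change e α ((e α).symm _) = f.app α (r • (e α).symm d)
          rw [BimodHom.map_smul_left, AddEquiv.apply_symm_apply]
          exact congrArg (r • ·) ((e α).apply_symm_apply d).symm
        map_smul_right' := fun s d => (h α).1 <| by
          change e α ((e α).symm _) = f.app α (op s • (e α).symm d)
          rw [BimodHom.map_smul_right, AddEquiv.apply_symm_apply]
          exact congrArg (op s • ·) ((e α).apply_symm_apply d).symm }
    have hgf : ∀ α, (g α).comp (f.app α) = BimodHom.id A A _ :=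
      fun α => BimodHom.ext fun c => (e α).symm_apply_apply c
    have hfg : ∀ α, (f.app α).comp (g α) = BimodHom.id A A _ :=
      fun α => BimodHom.ext fun c => (e α).apply_symm_apply c
    refine ⟨⟨g, fun α β γ hγ d => ?_, fun d => ?_⟩, GroupCoring.Hom.ext (funext hgf),
      GroupCoring.Hom.ext (funext hfg)⟩
    · obtain ⟨c, rfl⟩ := (h γ).2 d
      rw [← f.map_comul, BTensor.map_map]
      have h1 : (g α).toRight ∘ₗ (f.app α).toRight = LinearMap.id :=
        LinearMap.ext fun c => DFunLike.congr_fun (hgf α) c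
      have h2 : (g β).toLeft ∘ₗ (f.app β).toLeft = LinearMap.id :=
        LinearMap.ext fun c => DFunLike.congr_fun (hgf β) c
      rw [h1, h2, BTensor.map_id_apply]
      exact congrArg _ (DFunLike.congr_fun (hgf γ) c).symm
    · rw [← f.map_counit]
      exact congrArg _ (DFunLike.congr_fun (hfg 1) d)

theorem GComodule.isIso_iff_bijective {C : GroupCoring G A} {M N : GComodule C} (f : M ⟶ N) :
    IsIso f ↔ ∀ α, Function.Bijective (f.app α) := by
  constructor
  · intro _ α
    have h1 : ∀ m, (inv f).app α (f.app α m) = m := fun m =>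
      DFunLike.congr_fun (congrFun (congrArg GComodule.Hom.app (IsIso.hom_inv_id f)) α) m
    have h2 : ∀ n, f.app α ((inv f).app α n) = n := fun n =>
      DFunLike.congr_fun (congrFun (congrArg GComodule.Hom.app (IsIso.inv_hom_id f)) α) n
    exact ⟨Function.LeftInverse.injective h1, Function.RightInverse.surjective h2⟩
  · intro h
    let e α : M.X α ≃ₗ[Aᵐᵒᵖ] N.X α := LinearEquiv.ofBijective (f.app α) (h α)
    have hgf : ∀ α, (e α).symm.toLinearMap ∘ₗ f.app α = LinearMap.id :=
      fun α => LinearMap.ext fun m => (e α).symm_apply_apply m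
    have hfg : ∀ α, f.app α ∘ₗ (e α).symm.toLinearMap = LinearMap.id :=
      fun α => LinearMap.ext fun n => (e α).apply_symm_apply n
    refine ⟨⟨fun α => (e α).symm.toLinearMap, fun α β γ hγ n => ?_⟩,
      GComodule.Hom.ext (funext hgf), GComodule.Hom.ext (funext hfg)⟩
    obtain ⟨m, rfl⟩ := (h γ).2 n
    rw [← f.comm, BTensor.map_map, hgf, LinearMap.comp_id, BTensor.map_id_apply]
    exact congrArg _ (DFunLike.congr_fun (hgf γ) m).symm

variable {B : Type u} [Ring B] {C : GroupCoring G A} (x : C.GrouplikeFamily)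
  (i : B →+* x.coinvariants)

theorem isIso_unit_iff_bijective : IsIso (adjunction7 x i).unit ↔
    ∀ (N : Type u) [AddCommGroup N] [Module Bᵐᵒᵖ N],
      Function.Bijective (unitLinear x i N) := by
  rw [NatTrans.isIso_iff_isIso_app]
  constructor
  · intro h N _ _
    exact (ConcreteCategory.isIso_iff_bijective _).1 (h (ModuleCat.of Bᵐᵒᵖ N))
  · intro h N
    exact (ConcreteCategory.isIso_iff_bijective ((adjunction7 x i).unit.app N)).2 (h N)

theorem isIso_counit_iff_bijective : IsIso (adjunction7 x i).counit ↔
    ∀ (M : GComodule C) (α : G), Function.Bijective (counitLinear x i M α) := by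
  rw [NatTrans.isIso_iff_isIso_app]
  exact forall_congr' fun M => GComodule.isIso_iff_bijective (counitHom x i M)

end Isomorphisms

/-! ### Restriction of scalars for right modules -/

/-- The right `A`-module `M`, regarded as a right `B`-module via `f : B → A`. -/
def RestrictRight {B A : Type u} [Ring B] [Ring A] (_f : B →+* A) (M : Type u) : Type u := M

namespace RestrictRight

variable {B A : Type u} [Ring B] [Ring A] (f : B →+* A) {M M' : Type u}
  [AddCommGroup M] [Module Aᵐᵒᵖ M] [AddCommGroup M'] [Module Aᵐᵒᵖ M']

/-- The element `m` of `M`, seen in the restricted module. -/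
def of (m : M) : RestrictRight f M := m

/-- The underlying element of `M`. -/
def val (m : RestrictRight f M) : M := m

instance : AddCommGroup (RestrictRight f M) := inferInstanceAs (AddCommGroup M)

instance : Module Bᵐᵒᵖ (RestrictRight f M) := Module.compHom M f.op

/-- An `A`-linear map, regarded as a `B`-linear map. -/
def map (g : M →ₗ[Aᵐᵒᵖ] M') : RestrictRight f M →ₗ[Bᵐᵒᵖ] RestrictRight f M' where
  toFun m := of f (g (m.val f))
  map_add' m m' := map_add g (m.val f) (m'.val f)
  map_smul' b m := map_smul g (f.op b) (m.val f)

variable (M) in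
/-- The action `M ⊗_B A → M`, `m ⊗ a ↦ m a`. -/
def action : BTensor B (RestrictRight f M) (ResLeft f) →ₗ[Aᵐᵒᵖ] M where
  toFun := BTensor.lift₂ B (fun m a => op (a.val f) • m.val f)
    (fun m m' a => smul_add _ (m.val f) (m'.val f))
    (fun m a a' => add_smul (op (a.val f)) (op (a'.val f)) (m.val f))
    (fun m b a => (mul_smul (op (a.val f)) (op (f b)) (m.val f)).symm)
  map_add' := map_add _
  map_smul' s t := by
    induction t using BTensor.induction with
    | tmul m a => exact mul_smul s (op (a.val f)) (m.val f)
    | add a b ha hb => rw [smul_add, map_add, ha, hb, map_add, smul_add]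

end RestrictRight

section Grouplike

variable {G A B : Type u} [Group G] [Ring A] [Ring B]
variable {C : GroupCoring G A} (x : C.GrouplikeFamily) (i : B →+* x.coinvariants)

theorem toA_smul_grouplike (b : B) (α : G) : toA x i b • x.x α = op (toA x i b) • x.x α :=
  (i b).2 α

/-! ### The canonical maps over the base ring -/

/-- The map `A ⊗_B A → C_α`, `a ⊗ b ↦ a x_α b`. It agrees with `can_α`, except that the tensor
product is taken over `B` instead of `A^{co C}`. -/
def baseCan (α : G) : BTensor B (ResRight (toA x i)) (leftA x i) →+ C.X α :=
  BTensor.lift₂ B (fun a b => a.val _ • op (b.val _) • x.x α)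
    (fun a a' b => add_smul (a.val _) (a'.val _) _)
    (fun a b b' => by
      change a.val _ • (op (b.val _) + op (b'.val _)) • x.x α = _
      rw [add_smul, smul_add])
    (fun a t b => by
      change (a.val _ * toA x i t) • op (b.val _) • x.x α =
        a.val _ • op (toA x i t * b.val _) • x.x α
      rw [mul_smul, smul_comm (toA x i t), toA_smul_grouplike, smul_smul (op (b.val _)), op_mul])

theorem baseCan_smul (α : G) (a : A) (t : BTensor B (ResRight (toA x i)) (leftA x i)) :
    baseCan x i α (a • t) = a • baseCan x i α t := by
  induction t using BTensor.induction with
  | tmul m n => exact mul_smul a (m.val _) _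
  | add s t hs ht => rw [smul_add, map_add, hs, ht, map_add, smul_add]

/-- If `i` is bijective, then `A ⊗_B A` and `A ⊗_T A`, where `T = A^{co C}`, are the same. -/
theorem baseCan_bijective_iff (hi : Function.Bijective i) (α : G) :
    Function.Bijective (baseCan x i α) ↔ Function.Bijective (canApp x α) := by
  let T := x.coinvariants
  let p : BTensor B (ResRight (toA x i)) (leftA x i) →+ SweedlerModule T.subtype :=
    BTensor.lift₂ B
      (fun a b => BTensor.tmul T (ResRight.of T.subtype (a.val _)) (ResLeft.of T.subtype (b.val _)))
      (fun a a' b =>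
        BTensor.add_tmul T (ResRight.of T.subtype (a.val _)) (ResRight.of _ (a'.val _)) _)
      (fun a b b' =>
        BTensor.tmul_add T _ (ResLeft.of T.subtype (b.val _)) (ResLeft.of _ (b'.val _)))
      (fun a r b => BTensor.smul_tmul T (ResRight.of T.subtype (a.val _)) (i r)
        (ResLeft.of T.subtype (b.val _)))
  let q : SweedlerModule T.subtype →+ BTensor B (ResRight (toA x i)) (leftA x i) :=
    BTensor.lift₂ T
      (fun a b => BTensor.tmul B (ResRight.of (toA x i) (a.val _)) (ResLeft.of (toA x i) (b.val _)))
      (fun a a' b =>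
        BTensor.add_tmul B (ResRight.of (toA x i) (a.val _)) (ResRight.of _ (a'.val _)) _)
      (fun a b b' =>
        BTensor.tmul_add B _ (ResLeft.of (toA x i) (b.val _)) (ResLeft.of _ (b'.val _)))
      (fun a t b => by
        obtain ⟨r, rfl⟩ := hi.2 t
        exact BTensor.smul_tmul B (ResRight.of (toA x i) (a.val _)) r
          (ResLeft.of (toA x i) (b.val _)))
  have hqp : q.comp p = AddMonoidHom.id _ := BTensor.addHom_ext fun _ _ => rfl
  have hpq : p.comp q = AddMonoidHom.id _ := BTensor.addHom_ext fun _ _ => rfl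
  have hp : Function.Bijective p :=
    ⟨Function.LeftInverse.injective (DFunLike.congr_fun hqp),
      Function.RightInverse.surjective (DFunLike.congr_fun hpq)⟩
  have h : (canApp x α).toAddMonoidHom.comp p = baseCan x i α :=
    BTensor.addHom_ext fun _ _ => rfl
  rw [← h]
  exact Function.Bijective.of_comp_iff (canApp x α) hp

theorem isGaloisGroupCoring_iff_baseCan (hi : Function.Bijective i) :
    IsGaloisGroupCoring x ↔ ∀ α, Function.Bijective (baseCan x i α) := by
  refine (GroupCoring.isIso_iff_bijective (can x)).trans (forall_congr' fun α => ?_)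
  exact (baseCan_bijective_iff x i hi α).symm

/-! ### Tensoring with the components of the coring -/

variable (M : Type u) [AddCommGroup M] [Module Aᵐᵒᵖ M]

/-- The map `M ⊗_B A → M ⊗_A C_β`, `m ⊗ a ↦ m ⊗ x_β a`. -/
def tensorGrouplike (β : G) :
    BTensor B (RestrictRight (toA x i) M) (leftA x i) →ₗ[Aᵐᵒᵖ] BTensor A M (C.X β) where
  toFun := BTensor.lift₂ B
    (fun m a => BTensor.tmul A (m.val _) (op (a.val (toA x i)) • x.x β))
    (fun m m' a => BTensor.add_tmul A (m.val _) (m'.val _) _)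
    (fun m a a' => by
      rw [← BTensor.tmul_add, ← add_smul]
      rfl)
    (fun m b a => by
      change BTensor.tmul A (op (toA x i b) • m.val _) (op (a.val _) • x.x β) =
        BTensor.tmul A (m.val _) (op (toA x i b * a.val _) • x.x β)
      rw [BTensor.smul_tmul, smul_comm (toA x i b), toA_smul_grouplike, smul_smul, op_mul])
  map_add' := map_add _
  map_smul' s t := by
    induction t using BTensor.induction with
    | tmul m a =>
      change BTensor.tmul A (m.val _) ((s * op (a.val (toA x i))) • x.x β) =
        BTensor.tmul A (m.val _) (s • op (a.val (toA x i)) • x.x β)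
      rw [mul_smul]
    | add a b ha hb => rw [smul_add, map_add, ha, hb, map_add, smul_add]

variable {M} in
@[simp]
theorem tensorGrouplike_tmul (β : G) (m : RestrictRight (toA x i) M) (a : leftA x i) :
    tensorGrouplike x i M β (BTensor.tmul B m a) =
      BTensor.tmul A (m.val _) (op (a.val (toA x i)) • x.x β) := rfl

variable {M} in
theorem tensorGrouplike_tmul_one (β : G) (m : M) :
    tensorGrouplike x i M β (BTensor.tmul B (RestrictRight.of _ m) (ResLeft.of _ 1)) =
      BTensor.tmul A m (x.x β) :=
  congrArg (BTensor.tmul A m) (one_smul Aᵐᵒᵖ (x.x β))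

/-- `M ⊗_B A ≅ M ⊗_A (A ⊗_B A) ≅ M ⊗_A C_β` if `A ⊗_B A ≅ C_β`. -/
theorem tensorGrouplike_bijective (β : G) (h : Function.Bijective (baseCan x i β)) :
    Function.Bijective (tensorGrouplike x i M β) := by
  let f := toA x i
  let e : BTensor B (ResRight f) (leftA x i) ≃+ C.X β := AddEquiv.ofBijective _ h
  -- `a ⊗ b ↦ m a ⊗ b` for fixed `m`
  let g (m : M) : BTensor B (ResRight f) (leftA x i) →+
      BTensor B (RestrictRight f M) (leftA x i) :=
    BTensor.lift₂ B
      (fun a b => BTensor.tmul B (RestrictRight.of f (op (a.val f) • m)) b)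
      (fun a a' b => by
        rw [← BTensor.add_tmul]
        exact congrArg (fun n => BTensor.tmul B n b) (add_smul (op (a.val f)) (op (a'.val f)) m))
      (fun a b b' => BTensor.tmul_add B _ b b')
      (fun a r b => by
        rw [← BTensor.smul_tmul]
        exact congrArg (fun n => BTensor.tmul B n b) (mul_smul (op (f r)) (op (a.val f)) m))
  have g_add : ∀ m m' t, g (m + m') t = g m t + g m' t := fun m m' t => by
    induction t using BTensor.induction with
    | tmul a b =>
      refine Eq.trans ?_ (BTensor.add_tmul B _ _ _)
      exact congrArg (fun n => BTensor.tmul B n b) (smul_add (op (a.val f)) m m')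
    | add s t hs ht => rw [map_add, hs, ht, map_add, map_add]; abel
  have g_smul : ∀ m (r : A) t, g (op r • m) t = g m (r • t) := fun m r t => by
    induction t using BTensor.induction with
    | tmul a b =>
      exact congrArg (fun n => BTensor.tmul B n b) (mul_smul (op (a.val f)) (op r) m).symm
    | add s t hs ht => rw [map_add, hs, ht, smul_add, map_add]
  have e_symm_smul : ∀ (r : A) c, e.symm (r • c) = r • e.symm c := fun r c => by
    rw [AddEquiv.symm_apply_eq]
    refine Eq.trans ?_ (baseCan_smul x i β r _).symm
    exact congrArg (r • ·) (e.apply_symm_apply c).symm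
  let inv : BTensor A M (C.X β) →+ BTensor B (RestrictRight f M) (leftA x i) :=
    BTensor.lift₂ A (fun m c => g m (e.symm c)) (fun m m' c => g_add m m' _)
      (fun m c c' => by rw [map_add, map_add])
      (fun m r c => by rw [g_smul, e_symm_smul])
  have hg : ∀ m t, tensorGrouplike x i M β (g m t) = BTensor.tmul A m (baseCan x i β t) :=
    fun m t => by
      induction t using BTensor.induction with
      | tmul a b => exact BTensor.smul_tmul A m (a.val f) _
      | add s t hs ht => rw [map_add, map_add, hs, ht, map_add, BTensor.tmul_add]
  have h1 : inv.comp (tensorGrouplike x i M β).toAddMonoidHom = AddMonoidHom.id _ :=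
    BTensor.addHom_ext fun m a => by
      have ha : e.symm (op (a.val f) • x.x β) = BTensor.tmul B (ResRight.of f 1) a := by
        rw [AddEquiv.symm_apply_eq]
        exact (one_smul A (op (a.val f) • x.x β)).symm
      change g (m.val f) (e.symm (op (a.val f) • x.x β)) = BTensor.tmul B m a
      rw [ha]
      exact congrArg (fun n => BTensor.tmul B n a) (one_smul Aᵐᵒᵖ (m.val f))
  have h2 : (tensorGrouplike x i M β).toAddMonoidHom.comp inv = AddMonoidHom.id _ :=
    BTensor.addHom_ext fun m c => (hg m (e.symm c)).trans
      (congrArg (BTensor.tmul A m) (e.apply_symm_apply c))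
  exact ⟨Function.LeftInverse.injective (DFunLike.congr_fun h1),
    Function.RightInverse.surjective (DFunLike.congr_fun h2)⟩

/-- If `A ⊗_B A ≅ C_β`, then there is a map `M ⊗_A C_β → M`, `m ⊗ x_β a ↦ m a`. -/
theorem exists_retraction (β : G) (h : Function.Bijective (baseCan x i β)) :
    ∃ μ : BTensor A M (C.X β) →ₗ[Aᵐᵒᵖ] M,
      ∀ t, μ (tensorGrouplike x i M β t) = RestrictRight.action (toA x i) M t := by
  let e := LinearEquiv.ofBijective _ (tensorGrouplike_bijective x i M β h)
  exact ⟨RestrictRight.action (toA x i) M ∘ₗ e.symm.toLinearMap, fun t =>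
    congrArg (RestrictRight.action (toA x i) M) (e.symm_apply_apply t)⟩

variable {M}

theorem tmul_grouplike_injective (β : G) (h : Function.Bijective (baseCan x i β)) :
    Function.Injective fun m : M => BTensor.tmul A m (x.x β) := by
  obtain ⟨μ, hμ⟩ := exists_retraction x i M β h
  refine Function.LeftInverse.injective (g := μ) fun m => ?_
  rw [← tensorGrouplike_tmul_one x i β m, hμ]
  exact one_smul Aᵐᵒᵖ m

/-- The map `M → M ⊗_A C_β`, `m ↦ m ⊗ x_β`; it is right `B`-linear because `B` commutes with
`x_β`. -/
def insertGrouplike (M : Type u) [AddCommGroup M] [Module Aᵐᵒᵖ M] (β : G) :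
    RestrictRight (toA x i) M →ₗ[Bᵐᵒᵖ] RestrictRight (toA x i) (BTensor A M (C.X β)) where
  toFun m := RestrictRight.of _ (BTensor.tmul A (m.val _) (x.x β))
  map_add' m m' := BTensor.add_tmul A (m.val _) (m'.val _) _
  map_smul' b m := by
    refine (BTensor.smul_tmul A (m.val _) (toA x i b.unop) _).trans ?_
    rw [toA_smul_grouplike]
    rfl

/-- Under `M ⊗_B A → M ⊗_A C_γ` the map `M ⊗_A Δ_{α,β}` corresponds to
`m ⊗ a ↦ (m ⊗ x_α) ⊗ a`. -/
theorem map_comul_tensorGrouplike (α β γ : G) (h : α * β = γ)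
    (t : BTensor B (RestrictRight (toA x i) M) (leftA x i)) :
    BTensor.map LinearMap.id (C.comul α β γ h).toLeft (tensorGrouplike x i M γ t) =
      BTensor.assoc (tensorGrouplike x i (BTensor A M (C.X α)) β
        (BTensor.map (insertGrouplike x i M α) LinearMap.id t)) := by
  induction t using BTensor.induction with
  | tmul m a =>
    have e : C.comul α β γ h (op (a.val (toA x i)) • x.x γ) =
        BTensor.tmul A (x.x α) (op (a.val (toA x i)) • x.x β) := by
      rw [BimodHom.map_smul_right, x.comul_x]
      rfl
    rw [tensorGrouplike_tmul, BTensor.map_tmul, BimodHom.toLeft_apply, e]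
    rfl
  | add s t hs ht => simp only [map_add, hs, ht]

/-- An element `u` of `M ⊗_A C_{αβ}` whose image under `M ⊗_A Δ_{α,β}` has the form `v ⊗ x_β` is
itself of the form `m ⊗ x_{αβ}`. -/
theorem exists_eq_tmul_grouplike (α β γ : G) (hγ : α * β = γ)
    (h : ∀ δ, Function.Bijective (baseCan x i δ)) (u : BTensor A M (C.X γ))
    (v : BTensor A M (C.X α))
    (huv : BTensor.map LinearMap.id (C.comul α β γ hγ).toLeft u =
      BTensor.assoc (BTensor.tmul A v (x.x β))) :
    ∃ m : M, u = BTensor.tmul A m (x.x γ) := by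
  obtain ⟨t, rfl⟩ := (tensorGrouplike_bijective x i M γ (h γ)).2 u
  obtain ⟨μ, hμ⟩ := exists_retraction x i M α (h α)
  rw [map_comul_tensorGrouplike, ← tensorGrouplike_tmul_one x i] at huv
  have h1 := (tensorGrouplike_bijective x i _ β (h β)).1 (BTensor.assoc.injective huv)
  -- `m ⊗ a ↦ (m ⊗ x_α) ⊗ a ↦ m ⊗ a`, where the second map is `μ ⊗ A`, is the identity.
  have h2 : ∀ t : BTensor B (RestrictRight (toA x i) M) (leftA x i),
      BTensor.map (RestrictRight.map (toA x i) μ) LinearMap.id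
        (BTensor.map (insertGrouplike x i M α) LinearMap.id t) = t := fun t => by
    rw [BTensor.map_map]
    refine Eq.trans ?_ (BTensor.map_id_apply t)
    congr 2
    refine LinearMap.ext fun m => ?_
    change μ (BTensor.tmul A (m.val _) (x.x α)) = m
    rw [← tensorGrouplike_tmul_one x i α (m.val _), hμ]
    exact one_smul Aᵐᵒᵖ (m.val _)
  refine ⟨μ v, ?_⟩
  rw [← h2 t, h1, ← tensorGrouplike_tmul_one x i]
  rfl

/-! ### Descent for comodules over a Galois group coring -/

/-- An element `m ∈ M_γ` with `ρ_{γ,e}(m) = m ⊗ x_e` extends to a family of coinvariants. -/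
theorem exists_coinv_component_eq (h : ∀ δ, Function.Bijective (baseCan x i δ))
    (M : GComodule C) (γ : G) (m : M.X γ)
    (hm : M.coact γ 1 γ (mul_one γ) m = BTensor.tmul A m (x.x 1)) :
    ∃ n : Coinv x i M, n.component γ = m := by
  have hex : ∀ α, ∃ n : M.X α, M.coact α (α⁻¹ * γ) γ (mul_inv_cancel_left α γ) m =
      BTensor.tmul A n (x.x (α⁻¹ * γ)) := fun α => by
    refine exists_eq_tmul_grouplike x i (α⁻¹ * γ) 1 _ (mul_one _) h _
      (M.coact α (α⁻¹ * γ) γ (mul_inv_cancel_left α γ) m) ?_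
    rw [M.coassoc α (α⁻¹ * γ) 1 γ _ γ (mul_inv_cancel_left α γ) (mul_one _) (mul_one γ), hm]
    rfl
  choose n hn using hex
  have hn' : ∀ α β (hβ : α * β = γ), M.coact α β γ hβ m = BTensor.tmul A (n α) (x.x β) := by
    intro α β hβ
    obtain rfl : β = α⁻¹ * γ := eq_inv_mul_of_mul_eq hβ
    exact hn α
  refine ⟨Coinv.mk x i n fun α β δ hδ => ?_, ?_⟩
  · -- `ρ_{α,β}(n_δ) ⊗ x_ε = n_α ⊗ x_β ⊗ x_ε` by coassociativity, where `γ = δ ε`.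
    refine tmul_grouplike_injective x i (δ⁻¹ * γ) (h _) (BTensor.assoc.injective ?_)
    have hδγ : δ * (δ⁻¹ * γ) = γ := mul_inv_cancel_left δ γ
    have hα : α * (β * (δ⁻¹ * γ)) = γ := by rw [← mul_assoc, hδ, hδγ]
    have hc := M.coassoc α β (δ⁻¹ * γ) δ _ γ hδ rfl hδγ hα m
    rw [hn' _ _ hα, hn' _ _ hδγ, BTensor.map_tmul, BTensor.map_tmul, BimodHom.toLeft_apply,
      x.comul_x] at hc
    exact hc.symm
  · refine tmul_grouplike_injective x i 1 (h 1) ?_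
    exact (hn' γ 1 (mul_one γ)).symm.trans hm

/-- A family of coinvariants is determined by each of its components. -/
theorem coinv_component_injective (h : ∀ δ, Function.Bijective (baseCan x i δ))
    (M : GComodule C) (γ : G) :
    Function.Injective fun n : Coinv x i M => n.component γ := by
  intro n n' hnn
  refine Coinv.ext fun α => tmul_grouplike_injective x i (α⁻¹ * γ) (h _) ?_
  have hγ := mul_inv_cancel_left α γ
  change BTensor.tmul A (n.component α) _ = BTensor.tmul A (n'.component α) _
  rw [← n.coact_component _ _ γ hγ, ← n'.coact_component _ _ γ hγ]
  exact congrArg _ hnn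

/-- The component map `M^{co C} → M_γ`. -/
def coinvComponent (M : GComodule C) (γ : G) :
    Coinv x i M →ₗ[Bᵐᵒᵖ] RestrictRight (toA x i) (M.X γ) where
  toFun n := RestrictRight.of _ (n.component γ)
  map_add' _ _ := rfl
  map_smul' _ _ := rfl

theorem GComodule.coact_one_injective (M : GComodule C) (γ : G) :
    Function.Injective (M.coact γ 1 γ (mul_one γ)) := fun m m' hm => by
  rw [← M.counit γ m, hm, M.counit]

/-- The identity `ρ_{γ,e}(∑ n_γ a) = ∑ n_γ ⊗ x_e a` for coinvariant families `n`. -/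
theorem tensorGrouplike_map_coinvComponent (M : GComodule C) (γ : G)
    (s : Ind x i (Coinv x i M)) :
    tensorGrouplike x i (M.X γ) 1 (BTensor.map (coinvComponent x i M γ) LinearMap.id s) =
      M.coact γ 1 γ (mul_one γ) (counitLinear x i M γ s) := by
  induction s using BTensor.induction with
  | tmul n a =>
    rw [counitLinear_tmul, map_smul, n.coact_component]
    rfl
  | add s t hs ht => simp only [map_add, hs, ht]

/-- Flat descent: since `M^{co C}` is the kernel of `ρ_{γ,e} - (- ⊗ x_e)` on `M_γ` and `A` is flat,
`M^{co C} ⊗_B A` is a kernel as well, and by coassociativity it is the image of `M_γ` under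
`ρ_{γ,e}`. -/
theorem counitLinear_bijective (h : ∀ δ, Function.Bijective (baseCan x i δ))
    (hA : IsLeftFlat B (leftA x i)) (M : GComodule C) (γ : G) :
    Function.Bijective (counitLinear x i M γ) := by
  have hθ := fun M [AddCommGroup M] [Module Aᵐᵒᵖ M] => tensorGrouplike_bijective x i M 1 (h 1)
  let ρ := M.coact γ 1 γ (mul_one γ)
  constructor
  · intro s s' hs
    refine hA _ _ (coinvComponent x i M γ) (coinv_component_injective x i h M γ)
      ((hθ (M.X γ)).1 ?_)
    rw [tensorGrouplike_map_coinvComponent, hs, tensorGrouplike_map_coinvComponent]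
  · intro m
    obtain ⟨t, ht⟩ := (hθ (M.X γ)).2 (ρ m)
    let p := RestrictRight.map (toA x i) ρ
    let q := insertGrouplike x i (M.X γ) (1 : G)
    have hp : ∀ t, tensorGrouplike x i _ 1 (BTensor.map p LinearMap.id t) =
        BTensor.map ρ LinearMap.id (tensorGrouplike x i (M.X γ) 1 t) := fun t => by
      induction t using BTensor.induction with
      | tmul n a => rfl
      | add s t hs ht => simp only [map_add, hs, ht]
    have hpq : BTensor.map p LinearMap.id t = BTensor.map q LinearMap.id t := by
      refine (hθ _).1 (BTensor.assoc.injective ?_)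
      rw [← map_comul_tensorGrouplike x i 1 1 1 (mul_one 1), hp, ht]
      exact (M.coassoc γ 1 1 γ 1 γ (mul_one γ) (mul_one 1) (mul_one γ) (mul_one γ) m).symm
    have hsub : ∀ t : BTensor B (RestrictRight (toA x i) (M.X γ)) (leftA x i),
        BTensor.map (p - q) LinearMap.id t =
          BTensor.map p LinearMap.id t - BTensor.map q LinearMap.id t := fun t => by
      induction t using BTensor.induction with
      | tmul n a => exact BTensor.sub_tmul (p n) (q n) a
      | add s t hs ht => rw [map_add, hs, ht, map_add, map_add]; abel
    obtain ⟨s, hs⟩ := BTensor.exists_map_eq_of_isLeftFlat hA (coinvComponent x i M γ) (p - q)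
      (fun n hn => exists_coinv_component_eq x i h M γ n (sub_eq_zero.1 hn)) t
      (by rw [hsub, hpq, sub_self])
    refine ⟨s, M.coact_one_injective γ ?_⟩
    rw [← tensorGrouplike_map_coinvComponent, hs, ht]

/-- By the triangle identity, `η_N ⊗_B A` is inverse to the counit at `N ⊗_B A`; faithful flatness
then makes `η_N` bijective. -/
theorem unitLinear_bijective (hA : IsLeftFaithfullyFlat B (leftA x i))
    (hc : ∀ (M : GComodule C) (α : G), Function.Bijective (counitLinear x i M α))
    (N : Type u) [AddCommGroup N] [Module Bᵐᵒᵖ N] :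
    Function.Bijective (unitLinear x i N) := by
  refine BTensor.bijective_of_map_bijective hA _ ?_
  let M := (functorG1 C).obj (indComodule x i N)
  have h := hc M 1
  have htri : ∀ t : Ind x i N, counitLinear x i M 1
      (BTensor.map (unitLinear x i N) LinearMap.id t) = t := fun t =>
    DFunLike.congr_fun (congrFun (congrArg GComodule.Hom.app
      ((adjunction7 x i).left_triangle_components (ModuleCat.of Bᵐᵒᵖ N))) 1) t
  exact ⟨Function.LeftInverse.injective htri, fun s => ⟨_, h.1 (htri _)⟩⟩

/-! ### The coring as a comodule over itself -/

/-- The `G`-`C`-comodule `C`, with coactions `Δ_{α,β}`. -/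
def regularGComodule (C : GroupCoring G A) : GComodule C where
  X := C.X
  coact α β γ h := (C.comul α β γ h).toRight
  coassoc α β γ αβ βγ αβγ h₁ h₂ h₃ h₄ c := (C.coassoc α β γ αβ βγ αβγ h₁ h₂ h₃ h₄ c).symm
  counit := C.right_counit

/-- The map `A → C^{co C}`, `a ↦ (a x_α)_α`. -/
def regularCoinv : ResRight (toA x i) →ₗ[Bᵐᵒᵖ] Coinv x i (regularGComodule C) where
  toFun a := Coinv.mk x i (M := regularGComodule C) (fun α => a.val _ • x.x α) fun α β γ h => by
    change C.comul α β γ h (a.val _ • x.x γ) = _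
    rw [BimodHom.map_smul_left, x.comul_x]
    rfl
  map_add' a a' := Coinv.ext fun α => add_smul (a.val _) (a'.val _) (x.x α)
  map_smul' b a := Coinv.ext fun α => by
    change (a.val _ * toA x i b.unop) • x.x α = op (toA x i b.unop) • a.val _ • x.x α
    rw [mul_smul, toA_smul_grouplike, smul_comm]

/-- The inverse map sends a family `(c_α)` to `ε(c_e)`. -/
theorem regularCoinv_bijective : Function.Bijective (regularCoinv x i) := by
  constructor
  · refine Function.LeftInverse.injective (g := fun n => C.counit (n.component 1)) fun a => ?_
    change C.counit (ResRight.val (toA x i) a • x.x 1) = a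
    rw [BimodHom.map_smul_left, x.counit_x]
    exact mul_one (ResRight.val (toA x i) a)
  · intro n
    refine ⟨ResRight.of _ (C.counit (n.component 1)), Coinv.ext fun α => ?_⟩
    have h := C.left_counit α (n.component α)
    have h' : C.comul 1 α α (one_mul α) (n.component α) =
      BTensor.tmul A (n.component 1) (x.x α) := n.coact_component 1 α α (one_mul α)
    rw [h'] at h
    exact h

theorem baseCan_bijective_of_counitLinear (α : G)
    (h : Function.Bijective (counitLinear x i (regularGComodule C) α)) :
    Function.Bijective (baseCan x i α) := by
  let e := LinearEquiv.ofBijective _ (regularCoinv_bijective x i)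
  have hmap : Function.Bijective
      (BTensor.map (regularCoinv x i) (LinearMap.id : leftA x i →ₗ[B] leftA x i)) := by
    have h1 : e.symm.toLinearMap ∘ₗ regularCoinv x i = LinearMap.id :=
      LinearMap.ext e.symm_apply_apply
    have h2 : regularCoinv x i ∘ₗ e.symm.toLinearMap = LinearMap.id :=
      LinearMap.ext e.apply_symm_apply
    refine ⟨Function.LeftInverse.injective (g := BTensor.map e.symm.toLinearMap LinearMap.id)
      fun t => ?_, Function.RightInverse.surjective
        (g := BTensor.map e.symm.toLinearMap LinearMap.id) fun t => ?_⟩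
    · rw [BTensor.map_map, h1, LinearMap.comp_id, BTensor.map_id_apply]
    · rw [BTensor.map_map, h2, LinearMap.comp_id, BTensor.map_id_apply]
  have hcomp : (counitLinear x i (regularGComodule C) α).toAddMonoidHom.comp
      (BTensor.map (regularCoinv x i) LinearMap.id) = baseCan x i α :=
    BTensor.addHom_ext fun a b => (smul_comm (a.val _) (op (b.val _)) (x.x α)).symm
  rw [← hcomp]
  exact h.comp hmap

/-! ### Consequences of the unit being an isomorphism -/

/-- The unit at the regular module `B` identifies `B` with the coinvariants of
`B ⊗_B A ≅ A`, among which are the constant families on the elements of `A^{co C}`. -/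
theorem bijective_of_unitLinear (h : Function.Bijective (unitLinear x i B)) :
    Function.Bijective i := by
  have hb : ∀ b : B, BTensor.tmul B b (ResLeft.of (toA x i) 1) =
      BTensor.tmul B (1 : B) (ResLeft.of (toA x i) (toA x i b)) := fun b => by
    have := BTensor.smul_tmul B (1 : B) b (ResLeft.of (toA x i) 1)
    rwa [op_smul_eq_mul, one_mul, ResLeft.smul_of, mul_one] at this
  constructor
  · intro b b' hbb
    refine h.1 (Coinv.ext fun α => ?_)
    change BTensor.tmul B b (ResLeft.of (toA x i) 1) = BTensor.tmul B b' (ResLeft.of (toA x i) 1)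
    have : toA x i b = toA x i b' := congrArg x.coinvariants.subtype hbb
    rw [hb, hb, this]
  · intro t
    let n : Coinv x i ((functorG1 C).obj (indComodule x i B)) :=
      Coinv.mk x i (M := (functorG1 C).obj (indComodule x i B))
        (fun _ => BTensor.tmul B (1 : B) (ResLeft.of (toA x i) (t : A))) fun α β γ _ => by
          change BTensor.tmul A (BTensor.tmul B (1 : B) (ResLeft.of (toA x i) 1))
            (op (t : A) • x.x β) = BTensor.tmul A _ (x.x β)
          rw [← t.2 β, ← BTensor.smul_tmul, BTensor.right_smul_tmul, ResLeft.op_smul_of, one_mul]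
    obtain ⟨b, hn⟩ := h.2 n
    have h1 : BTensor.tmul B b (ResLeft.of (toA x i) 1) =
        BTensor.tmul B (1 : B) (ResLeft.of (toA x i) (t : A)) :=
      congrArg (fun n => Coinv.component n (1 : G)) hn
    have h2 := congrArg (BTensor.lid B (leftA x i)) ((hb b).symm.trans h1)
    rw [BTensor.lid_tmul, BTensor.lid_tmul, one_smul, one_smul] at h2
    exact ⟨b, Subtype.ext h2⟩

theorem subsingleton_of_unitLinear (N : Type u) [AddCommGroup N] [Module Bᵐᵒᵖ N]
    (h : Function.Injective (unitLinear x i N)) (hN : Subsingleton (BTensor B N (leftA x i))) :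
    Subsingleton N :=
  ⟨fun _ _ => h (Coinv.ext fun _ => hN.elim _ _)⟩

end Grouplike

theorem theorem5p12 {G A B : Type u} [Group G] [Ring A] [Ring B]
    (C : GroupCoring G A) (x : C.GrouplikeFamily) (i : B →+* x.coinvariants) :
    (Function.Bijective i ∧ IsGaloisGroupCoring x ∧ IsLeftFaithfullyFlat B (leftA x i)) ↔
      ((IsIso (adjunction7 x i).unit ∧ IsIso (adjunction7 x i).counit) ∧
        IsLeftFlat B (leftA x i)) := by
  rw [isIso_unit_iff_bijective, isIso_counit_iff_bijective]
  constructor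
  · rintro ⟨hi, hG, hA⟩
    have hc := counitLinear_bijective x i ((isGaloisGroupCoring_iff_baseCan x i hi).1 hG) hA.1
    exact ⟨⟨fun N _ _ => unitLinear_bijective x i hA hc N, hc⟩, hA.1⟩
  · rintro ⟨⟨hu, hc⟩, hA⟩
    have hi := bijective_of_unitLinear x i (hu B)
    exact ⟨hi, (isGaloisGroupCoring_iff_baseCan x i hi).2 fun α =>
      baseCan_bijective_of_counitLinear x i α (hc _ α),
      hA, fun N _ _ hN => subsingleton_of_unitLinear x i N (hu N).1 hN⟩
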